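/- **Setting.** Let $O\subset\mathbb R^d$ be a bounded domain with Lebesgue measure, $p\in(1,\infty)$, $p'=p/(p-1)$, $\kappa\ge 0$, $\tau>0$, and let $S(A)=(\kappa+|A|^2)^{(p-2)/2}A$ for $A\in\mathbb R^{d\times d}$. Write $(\cdot,\cdot)$ for the integral pairings over $O$. Let $\sigma\in L^\infty(O;\mathbb R^d)$ (for instance a divergence-free field in $W^{1,\infty}$) and let $W$ be a real Wiener process on a probability space $(\Omega,\mathcal F,\mathbb P)$. A *gradient discretisation* $\mathcal D$ consists of finite-dimensional real vector spaces $X$ (velocities) and $Y$ (pressures) and linear maps $\nabla_{\mathcal D},\varepsilon_{\mathcal D}:X\to L^p(O)^{d\times d}$, $\mathrm{div}_{\mathcal D}:X\to L^p(O)$, $\Pi_{\mathcal D}:X\to L^2(O)^d$, $\chi_{\mathcal D}:Y\to L^{\min(p,p')}(O)$. With $Y_0=\{q\in Y:\int_O\chi_{\mathcal D}q\,dx=0\}$ and $E=\{v\in X: (\chi_{\mathcal D}q,\mathrm{div}_{\mathcal D}v)=0\ \forall q\in Y_0\}$ it is required that $\|\varepsilon_{\mathcal D}\cdot\|_{L^p}$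 is a norm on $X$, that $\|\chi_{\mathcal D}\cdot\|_{L^{\min(p,p')}}$ is a norm on $Y_0$, and that $\Pi_{\mathcal D}$ is one-to-one on $E$. Assume that $\mathcal D$ is stable: $\varepsilon_{\mathcal D}v\in L^{p'}$ for all $v\in X$, and for some $\Gamma\in[1,\infty)$ one has $C_{\mathcal D}(p)+C_{\mathcal D}(p')\le\Gamma$ and $\beta_{\mathcal D}\ge\Gamma^{-1}$, where $$C_{\mathcal D}(r)=\sup_{0\ne v\in X}\frac{\|\Pi_{\mathcal D}v\|_{L^r}+\|\mathrm{div}_{\mathcal D}v\|_{L^r}+\|\nabla_{\mathcal D}v\|_{L^r}}{\|\varepsilon_{\mathcal D}v\|_{L^r}},\qquad \beta_{\mathcal D}=\inf_{0\ne q\in Y_0}\sup_{0\ne v\in X}\frac{(\chi_{\mathcal D}q,\mathrm{div}_{\mathcal D}v)}{\|\chi_{\mathcal D}q\|_{L^{\min(p,p')}}\big(\|\varepsilon_{\mathcal D}v\|_{L^p}+\|\varepsilon_{\mathcal D}v\|_{L^{p'}}\big)} .$$ (The supremum is $0$ over the empty set, the infimum $+\infty$.) Put $B^\sigma_{\mathcal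 D}(v,\xi)=\tfrac12(\sigma^T\nabla_{\mathcal D}v,\Pi_{\mathcal D}\xi)-\tfrac12(\Pi_{\mathcal D}v,\sigma^T\nabla_{\mathcal D}\xi)$. For $v^{\rm in}\in L^2(O)^d$ and boundary datum $g$, the discrete solution $(v^n,\pi^n)\in X\times Y_0$ is defined by $$(\Pi_{\mathcal D}v^0,\Pi_{\mathcal D}\xi)+(\chi_{\mathcal D}\pi^0,\mathrm{div}_{\mathcal D}\xi)=(v^{\rm in},\Pi_{\mathcal D}\xi),\qquad (\mathrm{div}_{\mathcal D}v^0,\chi_{\mathcal D}q)=0,$$ and, with $v^{n+1/2}=\tfrac12(v^{n+1}+v^n)$ and $\Delta_{n+1}W=W((n+1)\tau)-W(n\tau)$, $$(\Pi_{\mathcal D}(v^{n+1}-v^n),\Pi_{\mathcal D}\xi)+\tau(S(\varepsilon_{\mathcal D}v^{n+1/2}+\varepsilon g),\varepsilon_{\mathcal D}\xi)-(\chi_{\mathcal D}(\pi^{n+1}-\pi^n),\mathrm{div}_{\mathcal D}\xi)=\big[B^\sigma_{\mathcal D}(v^{n+1/2},\xi)+((\sigma\cdot\nabla)g,\Pi_{\mathcal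 D}\xi)\big]\Delta_{n+1}W,$$ $$(\mathrm{div}_{\mathcal D}v^{n+1/2},\chi_{\mathcal D}q)=0,$$ for all $\xi\in X$, $q\in Y_0$. Let $(\mathcal P^n_{\tau,\mathcal D}f)(v^{\rm in})=\mathbb E[f(\Pi_{\mathcal D}v^n)]$ for $f\in C_b(L^2(O)^d)$. A Borel probability measure $\mu$ on $L^2(O)^d$ is *invariant* if $\int\mathcal P^n_{\tau,\mathcal D}f\,d\mu=\int f\,d\mu$ for all $n\ge1$ and $f\in C_b(L^2(O)^d)$. Finally, for Borel sets $A\subset L^2(O)^d$ let $$\mu^N(v^{\rm in};A)=\frac1N\sum_{n=0}^{N-1}\mathbb P(\Pi_{\mathcal D}v^n\in A),\qquad \mu^{1/2,N}(v^{\rm in};A)=\frac1N\sum_{n=0}^{N-1}\mathbb P(\Pi_{\mathcal D}v^{n+1/2}\in A).$$ **Statement (trivial boundary conditions).** Let $g=0$. Then: 1. A Borel probability measure on $L^2(O)^d$ is invariant with respect to $\mathcal P_{\tau,\mathcal D}$ if and only if it is the Dirac measure $\delta_0$. For every $v^{\rm in}\in L^2(O)^d$, moreover: 2. $\mathbb P$-almost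 surely, $\Pi_{\mathcal D}v^n\to0$ in $L^2(O)^d$ as $n\to\infty$. 3. $\mathbb P$-almost surely, $\Pi_{\mathcal D}v^{n+1/2}\to0$ in $L^2(O)^d$ as $n\to\infty$. 4. $\mu^N(v^{\rm in};\cdot)\to\delta_0$ weakly as $N\to\infty$. 5. $\mu^{1/2,N}(v^{\rm in};\cdot)\to\delta_0$ weakly as $N\to\infty$. -/

import Mathlib

open MeasureTheory ProbabilityTheory Filter Topology
open scoped ENNReal NNReal BoundedContinuousFunction

namespace StochStokes

/-- Vectors in `ℝ^d`, with the Euclidean norm. -/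
abbrev Vec (d : ℕ) := EuclideanSpace ℝ (Fin d)

/-- Real `d × d` matrices, with the inner product `A : B = ∑ i j, A i j * B i j` and its norm. -/
abbrev Mat (d : ℕ) := EuclideanSpace ℝ (Fin d × Fin d)

/-- The space `L²(O; ℝ^d)`. -/
noncomputable abbrev L2 {d : ℕ} (O : Set (Vec d)) := Lp (Vec d) 2 (volume.restrict O)

noncomputable instance instMeasurableSpaceL2 {d : ℕ} (O : Set (Vec d)) : MeasurableSpace (L2 O) := borel _

instance instBorelSpaceL2 {d : ℕ} (O : Set (Vec d)) : BorelSpace (L2 O) := ⟨rfl⟩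

/-- The viscous stress tensor `S(A) = (κ + |A|²)^((p-2)/2) A` of a power-law fluid. -/
noncomputable def stress {d : ℕ} (κ p : ℝ) (A : Mat d) : Mat d :=
  (κ + ‖A‖ ^ 2) ^ ((p - 2) / 2) • A

/-- The product `sᵀ G` of a row vector and a matrix. -/
noncomputable def rowMul {d : ℕ} (s : Vec d) (G : Mat d) : Vec d :=
  WithLp.toLp 2 fun i => ∑ j, s j * G (j, i)

/-- The symmetric gradient `(∇g + (∇g)ᵀ) / 2` of a vector field. -/
noncomputable def symGrad {d : ℕ} (g : Vec d → Vec d) (x : Vec d) : Mat d :=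
  WithLp.toLp 2 fun ij =>
    (fderiv ℝ g x (EuclideanSpace.single ij.1 1) ij.2
      + fderiv ℝ g x (EuclideanSpace.single ij.2 1) ij.1) / 2

/-- A gradient discretisation on `O` for the growth index `p`, with finite dimensional spaces `X`
of discrete velocities and `Y` of discrete pressures. Since all reconstructions are linear, "the
norm of the reconstruction is a norm" is the stated injectivity. The pressure is reconstructed in
`L^(min p p')` with `p' = p / (p - 1)`. -/
structure GradientDiscretisation {d : ℕ} (O : Set (Vec d)) (p : ℝ) (X Y : Type*)
    [AddCommGroup X] [Module ℝ X] [FiniteDimensional ℝ X]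
    [AddCommGroup Y] [Module ℝ Y] [FiniteDimensional ℝ Y] where
  /-- discrete gradient -/
  grad : X →ₗ[ℝ] Lp (Mat d) (ENNReal.ofReal p) (volume.restrict O)
  /-- discrete symmetric gradient -/
  eps : X →ₗ[ℝ] Lp (Mat d) (ENNReal.ofReal p) (volume.restrict O)
  /-- reconstruction of the pressure -/
  chi : Y →ₗ[ℝ] Lp ℝ (ENNReal.ofReal (min p (p / (p - 1)))) (volume.restrict O)
  /-- discrete divergence -/
  dvg : X →ₗ[ℝ] Lp ℝ (ENNReal.ofReal p) (volume.restrict O)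
  /-- reconstruction of the velocity -/
  vel : X →ₗ[ℝ] L2 O
  eps_injective : Function.Injective eps
  chi_injOn : ∀ q : Y, ∫ x in O, chi q x = 0 → chi q = 0 → q = 0
  vel_injOn : Set.InjOn vel
    {v : X | ∀ q : Y, ∫ x in O, chi q x = 0 → ∫ x in O, chi q x * dvg v x = 0}

namespace GradientDiscretisation

variable {d : ℕ} {O : Set (Vec d)} {p : ℝ} {X Y : Type*}
  [AddCommGroup X] [Module ℝ X] [FiniteDimensional ℝ X]
  [AddCommGroup Y] [Module ℝ Y] [FiniteDimensional ℝ Y]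

/-- Discrete pressures with vanishing mean value. -/
def Y₀ (D : GradientDiscretisation O p X Y) : Set Y := {q | ∫ x in O, D.chi q x = 0}

/-- The coercivity constant `C_D(r)`. -/
noncomputable def coercivityConst (D : GradientDiscretisation O p X Y) (r : ℝ) : ℝ≥0∞ :=
  ⨆ v : X,
    (eLpNorm (D.vel v) (ENNReal.ofReal r) (volume.restrict O)
      + eLpNorm (D.dvg v) (ENNReal.ofReal r) (volume.restrict O)
      + eLpNorm (D.grad v) (ENNReal.ofReal r) (volume.restrict O))
    / eLpNorm (D.eps v) (ENNReal.ofReal r) (volume.restrict O)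

/-- The inf-sup constant `β_D(p)`; the infimum runs over the nonzero mean-free pressures. Negative
quotients may be truncated, because the quotient is odd in `v`. -/
noncomputable def infSupConst (D : GradientDiscretisation O p X Y) : ℝ≥0∞ :=
  ⨅ q : Y, ⨅ _ : q ∈ D.Y₀ ∧ q ≠ 0, ⨆ v : X,
    ENNReal.ofReal (∫ x in O, D.chi q x * D.dvg v x)
    / (eLpNorm (D.chi q) (ENNReal.ofReal (min p (p / (p - 1)))) (volume.restrict O)
      * (eLpNorm (D.eps v) (ENNReal.ofReal p) (volume.restrict O)
        + eLpNorm (D.eps v) (ENNReal.ofReal (p / (p - 1))) (volume.restrict O)))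

/-- Stability with constant `Γ`: the coercivity constants for `p` and `p' = p / (p - 1)` and the
inf-sup constant are controlled by `Γ`. The first field expresses that the `L^(p')`-norms of the
discrete symmetric gradients, which are the denominators in these constants, are finite. -/
structure IsStable (D : GradientDiscretisation O p X Y) (Γ : ℝ) : Prop where
  eps_memLp : ∀ v : X, MemLp (D.eps v) (ENNReal.ofReal (p / (p - 1))) (volume.restrict O)
  coercivity : D.coercivityConst p + D.coercivityConst (p / (p - 1)) ≤ ENNReal.ofReal Γ
  infSup : (ENNReal.ofReal Γ)⁻¹ ≤ D.infSupConst

/-- The skew-symmetric discrete noise coefficient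
`B(v, ξ) = ½ (σᵀ ∇_D v, Π_D ξ) - ½ (Π_D v, σᵀ ∇_D ξ)`. -/
noncomputable def noiseForm (D : GradientDiscretisation O p X Y) (σ : Vec d → Vec d)
    (v ξ : X) : ℝ :=
  (1 / 2) * (∫ x in O, inner ℝ (rowMul (σ x) (D.grad v x)) (D.vel ξ x))
    - (1 / 2) * ∫ x in O, inner ℝ (D.vel v x) (rowMul (σ x) (D.grad ξ x))

/-- The discrete Helmholtz decomposition defining the initial pair `z = (v⁰, π⁰)`. -/
def IsInitial (D : GradientDiscretisation O p X Y) (vin : L2 O) (z : X × Y) : Prop :=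
  z.2 ∈ D.Y₀ ∧
  (∀ ξ : X, inner ℝ (D.vel z.1) (D.vel ξ) + (∫ x in O, D.chi z.2 x * D.dvg ξ x)
    = inner ℝ vin (D.vel ξ)) ∧
  ∀ q ∈ D.Y₀, ∫ x in O, D.dvg z.1 x * D.chi q x = 0

/-- One Crank-Nicolson step with boundary datum `g`, noise coefficient `σ`, step size `τ` and noise
increment `dW`, leading from the pair `z = (vⁿ, πⁿ)` to the pair `z' = (vⁿ⁺¹, πⁿ⁺¹)`. -/
def IsStep (D : GradientDiscretisation O p X Y) (κ τ : ℝ) (g σ : Vec d → Vec d) (dW : ℝ)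
    (z z' : X × Y) : Prop :=
  z'.2 ∈ D.Y₀ ∧
  (∀ ξ : X,
    inner ℝ (D.vel z'.1 - D.vel z.1) (D.vel ξ)
      + τ * (∫ x in O, inner ℝ
          (stress κ p (D.eps ((1 / 2 : ℝ) • (z'.1 + z.1)) x + symGrad g x)) (D.eps ξ x))
      - (∫ x in O, (D.chi z'.2 x - D.chi z.2 x) * D.dvg ξ x)
    = (D.noiseForm σ ((1 / 2 : ℝ) • (z'.1 + z.1)) ξ
        + ∫ x in O, inner ℝ (fderiv ℝ g x (σ x)) (D.vel ξ x)) * dW) ∧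
  ∀ q ∈ D.Y₀, ∫ x in O, D.dvg ((1 / 2 : ℝ) • (z'.1 + z.1)) x * D.chi q x = 0

/-- The discrete velocity-pressure pairs generated from `vin` by the noise increments
`dW 0, dW 1, …`: each one is the solution of `IsInitial`, respectively of `IsStep`
(`Classical.epsilon P` satisfies `P` as soon as `P` is satisfiable, and is otherwise an
unspecified element). -/
noncomputable def trajectory (D : GradientDiscretisation O p X Y) (κ τ : ℝ) (g σ : Vec d → Vec d)
    (vin : L2 O) (dW : ℕ → ℝ) : ℕ → X × Y
  | 0 => Classical.epsilon (D.IsInitial vin)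
  | n + 1 => Classical.epsilon (D.IsStep κ τ g σ (dW n) (trajectory D κ τ g σ vin dW n))

section Random

variable {Ω : Type*}

/-- The integer solution operator: the discrete velocity `vⁿ` driven by the increments
`W((k+1)τ) - W(kτ)`. -/
noncomputable def sol (D : GradientDiscretisation O p X Y) (κ : ℝ) (τ : ℝ≥0)
    (g σ : Vec d → Vec d) (W : ℝ≥0 → Ω → ℝ) (n : ℕ) (vin : L2 O) (ω : Ω) : X :=
  (D.trajectory κ τ g σ vin
    (fun k => W (((k + 1 : ℕ) : ℝ≥0) * τ) ω - W ((k : ℝ≥0) * τ) ω) n).1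

/-- The shifted integer solution operator: the discrete velocity
`vⁿ⁺¹ᐟ² = (vⁿ⁺¹ + vⁿ) / 2`. -/
noncomputable def solHalf (D : GradientDiscretisation O p X Y) (κ : ℝ) (τ : ℝ≥0)
    (g σ : Vec d → Vec d) (W : ℝ≥0 → Ω → ℝ) (n : ℕ) (vin : L2 O) (ω : Ω) : X :=
  (1 / 2 : ℝ) • (D.sol κ τ g σ W (n + 1) vin ω + D.sol κ τ g σ W n vin ω)

variable [MeasurableSpace Ω]

/-- The discrete transition semigroup `(Pⁿ f)(vin) = 𝔼[f(Π_D vⁿ)]`. -/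
noncomputable def semigroup (D : GradientDiscretisation O p X Y) (κ : ℝ) (τ : ℝ≥0)
    (g σ : Vec d → Vec d) (W : ℝ≥0 → Ω → ℝ) (P : Measure Ω) (n : ℕ) (f : L2 O →ᵇ ℝ)
    (vin : L2 O) : ℝ :=
  ∫ ω, f (D.vel (D.sol κ τ g σ W n vin ω)) ∂P

/-- Invariance of a measure on `L²(O)` with respect to the discrete transition semigroup. -/
def IsInvariant (D : GradientDiscretisation O p X Y) (κ : ℝ) (τ : ℝ≥0)
    (g σ : Vec d → Vec d) (W : ℝ≥0 → Ω → ℝ) (P : Measure Ω) (μ : Measure (L2 O)) : Prop :=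
  ∀ n : ℕ, 1 ≤ n → ∀ f : L2 O →ᵇ ℝ,
    ∫ v, D.semigroup κ τ g σ W P n f v ∂μ = ∫ v, f v ∂μ

end Random

end GradientDiscretisation

/-- The time-averaged law `A ↦ (1/N) ∑_{n < N} P(Zₙ ∈ A)` of a sequence of random elements. -/
noncomputable def averagedLaw {Ω H : Type*} [MeasurableSpace Ω] [MeasurableSpace H]
    (P : Measure Ω) (Z : ℕ → Ω → H) (N : ℕ) : Measure H :=
  (N : ℝ≥0∞)⁻¹ • ∑ n ∈ Finset.range N, P.map (Z n)

/-- Weak convergence of measures, tested with bounded continuous functions. -/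
def WeaklyTendsto {H : Type*} [MeasurableSpace H] [TopologicalSpace H]
    (μ : ℕ → Measure H) (ν : Measure H) : Prop :=
  ∀ f : H →ᵇ ℝ, Tendsto (fun N => ∫ v, f v ∂(μ N)) atTop (𝓝 (∫ v, f v ∂ν))

end StochStokes

open StochStokes

/-! Testing with discretely divergence-free fields removes the pressure, and on these fields the
reconstruction `D.vel` is injective. Hence the scheme lives on a finite-dimensional subspace of `L2
O`, where it is the midpoint rule for `du + S(u) dt = B u dW`, with `S` monotone, continuous and
strictly dissipative and `B` skew. Conversely, a residual vanishing on divergence-free fields is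
represented by a discrete pressure, so each midpoint step lifts to a full step. Existence of a step
follows from Minty's method, and uniqueness and continuous dependence from monotonicity.

Testing with the midpoint `w n` kills the noise and gives the pathwise identity `‖u (n+1)‖² + 2τ S(w
n, w n) = ‖u n‖²`, whatever the increment (`IsDissipative.energy`). So the norms decrease to a
limit, the dissipation tends to zero, and by compactness the midpoints tend to zero. This does not
yet give `u n → 0`, because `u (n+1) ≈ -u n` is still possible. Along indices with bounded noise
increments, however, the equation forces `u (n+1) - u n → 0`, hence `u n → 0` there, and
monotonicity of the norms extends this to the full sequence (`IsDissipative.tendsto_zero`).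

Such indices exist almost surely: the increments share one law with finite first moment, so by Fatou
the lower limit of their absolute values is finite. Independence plays no role. Dominated
convergence turns the pathwise limit into the statements on averaged laws and invariant measures. -/

namespace StochStokes

/-! ### Monotone operators and the midpoint rule in a finite-dimensional inner product space -/

section Abstract

variable {V : Type*} [NormedAddCommGroup V] [InnerProductSpace ℝ V]

/-- A finite family of monotonicity inequalities has a common solution in the convex hull. -/
theorem exists_mem_convexHull_forall_le {ι : Type*} [Fintype ι] [Nonempty ι]
    (a : V → V →ₗ[ℝ] ℝ) (ha : ∀ u v, 0 ≤ a u (u - v) - a v (u - v)) (y : ι → V) :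
    ∃ x ∈ convexHull ℝ (Set.range y), ∀ i, 0 ≤ a (y i) (y i - x) := by
  classical
  -- A bilinear zero-sum game on the simplex: the minimiser's strategy `s` weights the operators,
  -- the maximiser's strategy `t` weights the points. The optimal `t` will be the barycentric
  -- coordinates of the solution.
  let f : (ι → ℝ) → (ι → ℝ) → ℝ := fun s t => ∑ i, ∑ j, s i * t j * a (y i) (y i - y j)
  have hfx : ∀ t, IsLinearMap ℝ (fun s => f s t) := fun t =>
    { map_add := fun s s' => by simp only [f, Pi.add_apply, add_mul, Finset.sum_add_distrib]
      map_smul := fun c s => by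
        simp only [f, Pi.smul_apply, smul_eq_mul, Finset.mul_sum, mul_assoc] }
  have hfy : ∀ s, IsLinearMap ℝ (fun t => f s t) := fun s =>
    { map_add := fun t t' => by
        simp only [f, Pi.add_apply, add_mul, mul_add, Finset.sum_add_distrib]
      map_smul := fun c t => by
        simp only [f, Pi.smul_apply, smul_eq_mul, Finset.mul_sum]
        refine Finset.sum_congr rfl fun i _ => Finset.sum_congr rfl fun j _ => by ring }
  have hne : (stdSimplex ℝ ι).Nonempty := ⟨_, single_mem_stdSimplex ℝ (Classical.arbitrary ι)⟩
  have hc := convex_stdSimplex ℝ ι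
  obtain ⟨s, hs, t, ht, hst⟩ := Sion.exists_isSaddlePointOn (f := f) hne hc
    (isCompact_stdSimplex ℝ ι)
    (fun t _ => (by fun_prop : Continuous fun s => f s t).lowerSemicontinuous.lowerSemicontinuousOn _)
    (fun t _ => (((hfx t).mk').convexOn hc).quasiconvexOn) hc hne (isCompact_stdSimplex ℝ ι)
    (fun s _ => (by fun_prop : Continuous fun t => f s t).upperSemicontinuous.upperSemicontinuousOn _)
    (fun s _ => (((hfy s).mk').concaveOn hc).quasiconcaveOn)
  refine ⟨∑ j, t j • y j, ?_, fun i => ?_⟩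
  · exact (convex_convexHull ℝ _).sum_mem (fun j _ => ht.1 j) ht.2
      fun j _ => subset_convexHull ℝ _ ⟨j, rfl⟩
  -- On the diagonal, symmetrising in `i, j` yields the monotonicity pairings with nonnegative
  -- weights. The saddle inequality against the pure strategy `i` then bounds the `i`-th expression
  -- below by `f s s`.
  · have h0 : 0 ≤ f s s := by
      have h2 : 0 ≤ f s s + f s s := by
        have : f s s + f s s = ∑ i, ∑ j, s i * s j *
            (a (y i) (y i - y j) - a (y j) (y i - y j)) := by
          nth_rewrite 2 [show f s s = ∑ i, ∑ j, s i * s j * a (y j) (y j - y i) by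
            simp only [f]; rw [Finset.sum_comm]
            refine Finset.sum_congr rfl fun i _ => Finset.sum_congr rfl fun j _ => by ring]
          simp only [f, ← Finset.sum_add_distrib]
          refine Finset.sum_congr rfl fun i _ => Finset.sum_congr rfl fun j _ => ?_
          rw [← neg_sub (y i) (y j), map_neg]; ring
        rw [this]
        exact Finset.sum_nonneg fun i _ => Finset.sum_nonneg fun j _ =>
          mul_nonneg (mul_nonneg (hs.1 i) (hs.1 j)) (ha _ _)
      linarith
    have h1 : f s s ≤ f (Pi.single i 1) t := hst _ (single_mem_stdSimplex ℝ i) _ hs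
    have h2 : f (Pi.single i 1) t = a (y i) (y i - ∑ j, t j • y j) := by
      simp only [f]
      rw [Finset.sum_eq_single i (fun k _ hk => by simp [hk]) (by simp)]
      have hsum : ∑ j, t j = 1 := ht.2
      simp only [Pi.single_eq_same, one_mul, map_sub, map_sum, map_smul, smul_eq_mul, mul_sub,
        Finset.sum_sub_distrib, ← Finset.sum_mul, hsum]
    linarith

/-- Minty's weak variational inequality on a compact convex set. -/
theorem exists_forall_minty [FiniteDimensional ℝ V] (a : V → V →ₗ[ℝ] ℝ)
    (ha : ∀ u v, 0 ≤ a u (u - v) - a v (u - v)) {K : Set V} (hK : IsCompact K)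
    (hKc : Convex ℝ K) (hKn : K.Nonempty) : ∃ x ∈ K, ∀ y ∈ K, 0 ≤ a y (y - x) := by
  have key : (K ∩ ⋂ y : K, {x | 0 ≤ a y (y - x)}).Nonempty := by
    -- Each inequality is affine in `x`, hence closed, so compactness reduces to finitely many `y`.
    refine hK.inter_iInter_nonempty _ (fun y => ?_) fun F => ?_
    · exact isClosed_le continuous_const
        ((LinearMap.continuous_of_finiteDimensional (a y)).comp (by fun_prop))
    · rcases F.eq_empty_or_nonempty with rfl | hF
      · simpa using hKn
      have : Nonempty F := hF.to_subtype
      obtain ⟨x, hx, h⟩ := exists_mem_convexHull_forall_le a ha (fun i : F => (i.1 : V))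
      refine ⟨x, convexHull_min ?_ hKc hx, ?_⟩
      · rintro _ ⟨i, rfl⟩; exact i.1.2
      · simp only [Set.mem_iInter]
        exact fun i hi => h ⟨i, hi⟩
  obtain ⟨x, hx, h⟩ := key
  refine ⟨x, hx, fun y hy => ?_⟩
  simpa using Set.mem_iInter.1 h ⟨y, hy⟩

/-- A continuous monotone operator that is coercive on a sphere has a zero. -/
theorem exists_zero_of_monotone [FiniteDimensional ℝ V] (a : V → V →ₗ[ℝ] ℝ)
    (ha : ∀ u v, 0 ≤ a u (u - v) - a v (u - v)) (hcont : ∀ ξ, Continuous fun u => a u ξ)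
    {R : ℝ} (hR : 0 < R) (hcoer : ∀ u, ‖u‖ = R → 0 < a u u) : ∃ x, a x = 0 := by
  obtain ⟨x, hxK, hx⟩ := exists_forall_minty a ha (isCompact_closedBall (0 : V) R)
    (convex_closedBall 0 R) ⟨0, by simp [hR.le]⟩
  have hvi : ∀ z ∈ Metric.closedBall (0 : V) R, 0 ≤ a x (z - x) := by
    intro z hz
    -- Minty's trick: insert the point `x + t • (z - x)`, divide by `t`, and let `t` decrease to
    -- zero.
    have ht : Tendsto (fun t : ℝ => a (x + t • (z - x)) (z - x)) (𝓝[>] 0) (𝓝 (a x (z - x))) := by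
      have : Continuous fun t : ℝ => a (x + t • (z - x)) (z - x) :=
        (hcont (z - x)).comp (by fun_prop)
      simpa using (this.tendsto 0).mono_left nhdsWithin_le_nhds
    refine ge_of_tendsto ht ?_
    filter_upwards [Ioc_mem_nhdsGT (zero_lt_one' ℝ)] with t ht
    have hmem := (convex_closedBall (0 : V) R).add_smul_sub_mem hxK hz ⟨ht.1.le, ht.2⟩
    have := hx _ hmem
    rw [add_sub_cancel_left, map_smul, smul_eq_mul] at this
    exact nonneg_of_mul_nonneg_right this ht.1
  have hle : a x x ≤ 0 := by
    have := hvi 0 (by simp [hR.le])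
    simpa using this
  -- Coercivity keeps `x` off the sphere, so small moves in every direction are admissible and the
  -- inequality becomes an equation.
  have hlt : ‖x‖ < R := by
    refine lt_of_le_of_ne (by simpa using hxK) fun h => ?_
    exact absurd (hcoer x h) (not_lt.2 hle)
  have hnn : ∀ ξ, 0 ≤ a x ξ := by
    intro ξ
    have h1 : ∀ᶠ t : ℝ in 𝓝[>] 0, ‖x + t • ξ‖ < R := by
      have : Continuous fun t : ℝ => ‖x + t • ξ‖ := by fun_prop
      have h := (this.tendsto 0).mono_left (nhdsWithin_le_nhds (s := Set.Ioi 0))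
      exact h.eventually_lt_const (by simpa using hlt)
    obtain ⟨t, ht, ht0⟩ := (h1.and self_mem_nhdsWithin).exists
    have := hvi (x + t • ξ) (by simpa using ht.le)
    rw [add_sub_cancel_left, map_smul, smul_eq_mul] at this
    exact nonneg_of_mul_nonneg_right this ht0
  refine ⟨x, LinearMap.ext fun ξ => le_antisymm ?_ (hnn ξ)⟩
  have := hnn (-ξ)
  rw [map_neg] at this
  simpa using this

/-- One step of the midpoint rule for `du + S(u) dt = B u dW`. -/
def IsMidpointStep (τ : ℝ) (S : V → V →ₗ[ℝ] ℝ) (B : V →ₗ[ℝ] V →ₗ[ℝ] ℝ) (c : ℝ) (u u' : V) :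
    Prop :=
  ∀ ξ, inner ℝ (u' - u) ξ + τ * S ((1 / 2 : ℝ) • (u' + u)) ξ = B ((1 / 2 : ℝ) • (u' + u)) ξ * c

/-- The structural properties of drift and noise operator. -/
structure IsDissipative (S : V → V →ₗ[ℝ] ℝ) (B : V →ₗ[ℝ] V →ₗ[ℝ] ℝ) : Prop where
  mono : ∀ u v, 0 ≤ S u (u - v) - S v (u - v)
  cont : ∀ ξ, Continuous fun u => S u ξ
  zero : S 0 = 0
  pos : ∀ u, u ≠ 0 → 0 < S u u
  skew : ∀ u, B u u = 0

variable {τ : ℝ} {S : V → V →ₗ[ℝ] ℝ} {B : V →ₗ[ℝ] V →ₗ[ℝ] ℝ}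

theorem IsDissipative.nonneg (h : IsDissipative S B) (u : V) : 0 ≤ S u u := by
  have := h.mono u 0
  simpa [h.zero] using this

/-- The unknown is the midpoint `w`, with `u' = 2w - u`; this makes the whole equation monotone in
`w`, since skewness removes the noise for increments of any size. -/
theorem IsDissipative.exists_step [FiniteDimensional ℝ V] (h : IsDissipative S B) (hτ : 0 ≤ τ)
    (c : ℝ) (u : V) : ∃ u', IsMidpointStep τ S B c u u' := by
  let a : V → V →ₗ[ℝ] ℝ := fun w => (2 : ℝ) • (innerₗ V (w - u)) + τ • S w - c • B w
  have hadef : ∀ w ξ, a w ξ = 2 * inner ℝ (w - u) ξ + τ * S w ξ - c * B w ξ := fun w ξ => by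
    simp [a, inner_sub_left]
  have hmono : ∀ w z, 0 ≤ a w (w - z) - a z (w - z) := by
    intro w z
    have h1 : a w (w - z) - a z (w - z) = 2 * inner ℝ (w - z) (w - z)
        + τ * (S w (w - z) - S z (w - z)) - c * B (w - z) (w - z) := by
      have e : inner ℝ (w - z) (w - z) = inner ℝ (w - u) (w - z) - inner ℝ (z - u) (w - z) := by
        rw [← inner_sub_left]; congr 1; abel
      rw [hadef, hadef, e, map_sub B w z, LinearMap.sub_apply]; ring
    rw [h1, h.skew, real_inner_self_eq_norm_sq]
    have := mul_nonneg hτ (h.mono w z)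
    have := sq_nonneg ‖w - z‖
    linarith
  have hcont : ∀ ξ, Continuous fun w => a w ξ := by
    intro ξ
    simp only [hadef]
    have h1 := h.cont ξ
    have h2 : Continuous fun w => B w ξ := LinearMap.continuous_of_finiteDimensional (B.flip ξ)
    fun_prop
  -- On the sphere of radius `‖u‖ + 1`, Cauchy-Schwarz makes `2⟪w - u, w⟫` positive, and the drift
  -- only helps.
  obtain ⟨w, hw⟩ := exists_zero_of_monotone a hmono hcont (R := ‖u‖ + 1) (by positivity) (by
    intro w hw
    rw [hadef, h.skew, inner_sub_left, real_inner_self_eq_norm_sq]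
    have h1 := mul_nonneg hτ (h.nonneg w)
    have h2 := real_inner_le_norm u w
    have h3 : ‖u‖ * ‖w‖ < ‖w‖ ^ 2 := by
      rw [hw, sq]; exact mul_lt_mul_of_pos_right (by linarith) (by positivity)
    linarith)
  refine ⟨(2 : ℝ) • w - u, fun ξ => ?_⟩
  have e1 : (2 : ℝ) • w - u - u = (2 : ℝ) • (w - u) := by module
  have e2 : (1 / 2 : ℝ) • ((2 : ℝ) • w - u + u) = w := by module
  have := LinearMap.congr_fun hw ξ
  rw [hadef, LinearMap.zero_apply] at this
  rw [e1, e2, inner_smul_left]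
  simp only [conj_trivial]
  linarith

/-- Test the difference of the two equations with the difference `δ` of the midpoints. Monotonicity
discards the drift, and skewness replaces `B w₁ δ` by `B w₂ δ`, so the bound involves only the
second solution. This gives both uniqueness and joint continuity in datum and increment. -/
theorem IsDissipative.norm_sub_le [FiniteDimensional ℝ V] (h : IsDissipative S B) (hτ : 0 ≤ τ)
    {c₁ c₂ : ℝ} {u₁ u₂ v₁ v₂ : V} (h₁ : IsMidpointStep τ S B c₁ u₁ v₁)
    (h₂ : IsMidpointStep τ S B c₂ u₂ v₂) :
    ‖v₁ - v₂‖ ≤ 3 * ‖u₁ - u₂‖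
      + |c₁ - c₂| * ‖LinearMap.toContinuousLinearMap (B ((1 / 2 : ℝ) • (v₂ + u₂)))‖ := by
  set w₁ := (1 / 2 : ℝ) • (v₁ + u₁) with hw₁
  set w₂ := (1 / 2 : ℝ) • (v₂ + u₂) with hw₂
  set M := ‖LinearMap.toContinuousLinearMap (B w₂)‖
  set δ := w₁ - w₂ with hδ
  have e1 := h₁ δ
  have e2 := h₂ δ
  rw [← hw₁] at e1
  rw [← hw₂] at e2
  have d : v₁ - u₁ - (v₂ - u₂) = (2 : ℝ) • (δ - (u₁ - u₂)) := by
    rw [hδ, hw₁, hw₂]; module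
  have e3 : inner ℝ (v₁ - u₁) δ - inner ℝ (v₂ - u₂) δ
      = 2 * ‖δ‖ ^ 2 - 2 * inner ℝ (u₁ - u₂) δ := by
    rw [← inner_sub_left, d, inner_smul_left, inner_sub_left, real_inner_self_eq_norm_sq]
    simp only [conj_trivial]; ring
  have e4 : B w₁ δ = B w₂ δ := by
    have := h.skew δ
    rw [hδ, map_sub B, LinearMap.sub_apply, ← hδ] at this
    linarith
  have e5 := mul_nonneg hτ (h.mono w₁ w₂)
  have e6 : (c₁ - c₂) * B w₂ δ ≤ |c₁ - c₂| * (M * ‖δ‖) := by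
    refine (le_abs_self _).trans ?_
    rw [abs_mul]
    exact mul_le_mul_of_nonneg_left
      ((LinearMap.toContinuousLinearMap (B w₂)).le_opNorm δ) (abs_nonneg _)
  have e7 := real_inner_le_norm (u₁ - u₂) δ
  have e8 : 2 * ‖δ‖ ^ 2 ≤ (2 * ‖u₁ - u₂‖ + |c₁ - c₂| * M) * ‖δ‖ := by
    rw [e4] at e1
    nlinarith
  have hM : 0 ≤ |c₁ - c₂| * M := by positivity
  have e9 : 2 * ‖δ‖ ≤ 2 * ‖u₁ - u₂‖ + |c₁ - c₂| * M := by
    rcases (norm_nonneg δ).eq_or_lt with h0 | h0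
    · linarith [norm_nonneg (u₁ - u₂)]
    · refine le_of_mul_le_mul_right ?_ h0
      linarith
  have e10 : v₁ - v₂ = (2 : ℝ) • δ - (u₁ - u₂) := by rw [hδ, hw₁, hw₂]; module
  rw [e10]
  refine (_root_.norm_sub_le _ _).trans ?_
  rw [norm_smul, Real.norm_eq_abs, abs_two]
  linarith

theorem IsDissipative.step_unique [FiniteDimensional ℝ V] (h : IsDissipative S B) (hτ : 0 ≤ τ)
    {c : ℝ} {u v₁ v₂ : V} (h₁ : IsMidpointStep τ S B c u v₁) (h₂ : IsMidpointStep τ S B c u v₂) :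
    v₁ = v₂ := by
  have := h.norm_sub_le hτ h₁ h₂
  rw [sub_self, sub_self, norm_zero, abs_zero, zero_mul, mul_zero, add_zero] at this
  exact sub_eq_zero.1 (norm_le_zero_iff.1 this)

theorem IsDissipative.continuous_step [FiniteDimensional ℝ V] (h : IsDissipative S B)
    (hτ : 0 ≤ τ) {Φ : V × ℝ → V} (hΦ : ∀ z, IsMidpointStep τ S B z.2 z.1 (Φ z)) :
    Continuous Φ := by
  refine continuous_iff_continuousAt.2 fun z => tendsto_iff_norm_sub_tendsto_zero.2 ?_
  refine squeeze_zero (fun _ => norm_nonneg _) (fun y => h.norm_sub_le hτ (hΦ y) (hΦ z)) ?_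
  set M := ‖LinearMap.toContinuousLinearMap (B ((1 / 2 : ℝ) • (Φ z + z.1)))‖
  have : Continuous fun y : V × ℝ => 3 * ‖y.1 - z.1‖ + |y.2 - z.2| * M := by fun_prop
  simpa using this.tendsto z

/-- Testing with the midpoint: the noise vanishes by skewness, and the increment telescopes because
`⟪u' + u, u' - u⟫` is a difference of squares. -/
theorem IsDissipative.energy (h : IsDissipative S B) {c : ℝ} {u u' : V}
    (hs : IsMidpointStep τ S B c u u') :
    ‖u'‖ ^ 2 + 2 * τ * S ((1 / 2 : ℝ) • (u' + u)) ((1 / 2 : ℝ) • (u' + u)) = ‖u‖ ^ 2 := by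
  have := hs ((1 / 2 : ℝ) • (u' + u))
  rw [h.skew, inner_smul_right, real_inner_comm, ← sub_eq_zero] at this
  have e : inner ℝ (u' + u) (u' - u) = ‖u'‖ ^ 2 - ‖u‖ ^ 2 := by
    rw [inner_add_left, inner_sub_right, inner_sub_right, real_inner_self_eq_norm_sq,
      real_inner_self_eq_norm_sq, real_inner_comm]; ring
  rw [e] at this
  linarith

theorem IsDissipative.norm_step_le (h : IsDissipative S B) (hτ : 0 ≤ τ) {c : ℝ} {u u' : V}
    (hs : IsMidpointStep τ S B c u u') : ‖u'‖ ≤ ‖u‖ := by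
  have h1 := h.energy hs
  have h2 := mul_nonneg hτ (h.nonneg ((1 / 2 : ℝ) • (u' + u)))
  exact (pow_le_pow_iff_left₀ (norm_nonneg _) (norm_nonneg _) two_ne_zero).1 (by linarith)

theorem tendsto_zero_of_forall_inner [FiniteDimensional ℝ V] {x : ℕ → V}
    (hx : ∀ ξ, Tendsto (fun n => inner ℝ (x n) ξ) atTop (𝓝 0)) : Tendsto x atTop (𝓝 0) := by
  let b := stdOrthonormalBasis ℝ V
  have : Tendsto (fun n => ∑ i, inner ℝ (x n) (b i) • b i) atTop (𝓝 (∑ i, (0 : ℝ) • b i)) :=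
    tendsto_finsetSum _ fun i _ => (hx (b i)).smul_const _
  simp only [zero_smul, Finset.sum_const_zero] at this
  refine this.congr fun n => ?_
  simp_rw [real_inner_comm (b _) (x n)]
  exact b.sum_repr' (x n)

theorem IsDissipative.continuous_diag [FiniteDimensional ℝ V] (h : IsDissipative S B) :
    Continuous fun u => S u u := by
  let b := stdOrthonormalBasis ℝ V
  have : (fun u => S u u) = fun u => ∑ i, inner ℝ (b i) u * S u (b i) := by
    ext u
    conv_lhs => rw [← b.sum_repr' u]
    rw [map_sum, b.sum_repr' u]
    simp
  rw [this]
  exact continuous_finsetSum _ fun i _ => (by fun_prop : Continuous fun u => inner ℝ (b i) u).mul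
    (h.cont _)

/-- A bounded sequence along which the dissipation vanishes tends to zero. -/
theorem IsDissipative.tendsto_zero_of_diag [FiniteDimensional ℝ V] (h : IsDissipative S B)
    {w : ℕ → V} {R : ℝ} (hR : ∀ n, ‖w n‖ ≤ R)
    (hw : Tendsto (fun n => S (w n) (w n)) atTop (𝓝 0)) : Tendsto w atTop (𝓝 0) := by
  rw [Metric.tendsto_atTop']
  intro ε hε
  -- On this compact shell the dissipation has a positive minimum, which the sequence eventually
  -- undercuts.
  let K : Set V := Metric.closedBall 0 R ∩ {v | ε ≤ ‖v‖}
  have hK : IsCompact K :=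
    (isCompact_closedBall 0 R).inter_right (isClosed_le continuous_const continuous_norm)
  rcases K.eq_empty_or_nonempty with hKe | hKn
  · refine ⟨0, fun n _ => ?_⟩
    by_contra! hn
    have : w n ∈ K := ⟨by simpa using hR n, by simpa using hn⟩
    simp [hKe] at this
  · obtain ⟨v, hv, hmin⟩ := hK.exists_isMinOn hKn h.continuous_diag.continuousOn
    have hv0 : v ≠ 0 := by
      rintro rfl
      have : ε ≤ ‖(0 : V)‖ := hv.2
      rw [norm_zero] at this
      linarith
    obtain ⟨N, hN⟩ := eventually_atTop.1 (hw.eventually_lt_const (h.pos v hv0))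
    refine ⟨N, fun n hn => ?_⟩
    by_contra! hn'
    have : w n ∈ K := ⟨by simpa using hR n, by simpa using hn'⟩
    exact absurd (hN n hn.le) (not_lt.2 (hmin this))

/-- If the noise increments stay bounded along a subsequence, the midpoint rule converges to `0`. -/
theorem IsDissipative.tendsto_zero [FiniteDimensional ℝ V] (h : IsDissipative S B) (hτ : 0 < τ)
    {u : ℕ → V} {c : ℕ → ℝ} (hu : ∀ n, IsMidpointStep τ S B (c n) (u n) (u (n + 1)))
    {R : ℝ} (hc : ∃ᶠ n in atTop, |c n| ≤ R) : Tendsto u atTop (𝓝 0) := by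
  set w : ℕ → V := fun n => (1 / 2 : ℝ) • (u (n + 1) + u n) with hw
  have hanti : Antitone fun n => ‖u n‖ := antitone_nat_of_succ_le fun n => h.norm_step_le hτ.le (hu n)
  have hlim := tendsto_atTop_ciInf hanti ⟨0, by rintro _ ⟨n, rfl⟩; positivity⟩
  have hdiss : Tendsto (fun n => S (w n) (w n)) atTop (𝓝 0) := by
    have h1 := (((hlim.pow 2).sub ((hlim.comp (tendsto_add_atTop_nat 1)).pow 2)).const_mul
      (2 * τ)⁻¹)
    rw [sub_self, mul_zero] at h1
    refine h1.congr fun n => ?_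
    have h2 := h.energy (hu n)
    simp only [Function.comp_apply]
    rw [← h2, add_sub_cancel_left, inv_mul_cancel_left₀ (by positivity)]
  have hwR : ∀ n, ‖w n‖ ≤ ‖u 0‖ := by
    intro n
    have h1 := hanti (Nat.zero_le (n + 1))
    have h2 := hanti (Nat.zero_le n)
    have h3 := norm_add_le (u (n + 1)) (u n)
    simp only [hw, norm_smul, norm_div, norm_one, Real.norm_ofNat]
    simp only at h1 h2
    linarith
  have hw0 : Tendsto w atTop (𝓝 0) := h.tendsto_zero_of_diag hwR hdiss
  obtain ⟨φ, hφ, hcφ⟩ := extraction_of_frequently_atTop hc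
  have hwφ : Tendsto (fun k => w (φ k)) atTop (𝓝 0) := hw0.comp hφ.tendsto_atTop
  -- Read off from the equation: drift and noise are evaluated at midpoints tending to zero, and
  -- along `φ` the noise factor is bounded.
  have hd : Tendsto (fun k => u (φ k + 1) - u (φ k)) atTop (𝓝 0) := by
    refine tendsto_zero_of_forall_inner fun ξ => ?_
    have h1 : Tendsto (fun k => S (w (φ k)) ξ) atTop (𝓝 0) := by
      have := ((h.cont ξ).tendsto 0).comp hwφ
      rwa [h.zero, LinearMap.zero_apply] at this
    have h2 : Tendsto (fun k => B (w (φ k)) ξ) atTop (𝓝 0) := by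
      have := ((LinearMap.continuous_of_finiteDimensional (B.flip ξ)).tendsto 0).comp hwφ
      rwa [map_zero] at this
    have h3 : Tendsto (fun k => B (w (φ k)) ξ * c (φ k)) atTop (𝓝 0) := by
      refine squeeze_zero_norm (a := fun k => ‖B (w (φ k)) ξ‖ * R) (fun k => ?_) ?_
      · rw [norm_mul]
        exact mul_le_mul_of_nonneg_left (hcφ k) (norm_nonneg _)
      · simpa using h2.norm.mul_const R
    have h4 := h3.sub (h1.const_mul τ)
    rw [mul_zero, sub_zero] at h4
    refine h4.congr fun k => ?_
    have := hu (φ k) ξ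
    simp only [hw]
    linarith
  -- `u n` is the midpoint minus half the increment.
  have huφ : Tendsto (fun k => u (φ k)) atTop (𝓝 0) := by
    have := hwφ.sub (hd.const_smul (1 / 2 : ℝ))
    rw [smul_zero, sub_zero] at this
    refine this.congr fun k => ?_
    simp only [hw]
    module
  rw [tendsto_zero_iff_norm_tendsto_zero] at huφ ⊢
  rwa [tendsto_nhds_unique huφ (hlim.comp hφ.tendsto_atTop)]

end Abstract

end StochStokes

namespace StochStokes

/-! ### The power-law stress and the viscous form -/

section Stress

variable {d : ℕ} {κ p : ℝ}

theorem stress_zero : stress κ p (0 : Mat d) = 0 := by simp [stress]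

/-- The scalar power law `t ↦ (κ + t²)^((p-2)/2) t` is nondecreasing. -/
theorem powerLaw_mono (hp : 1 < p) (hκ : 0 ≤ κ) {s t : ℝ} (hs : 0 ≤ s) (hst : s ≤ t) :
    (κ + s ^ 2) ^ ((p - 2) / 2) * s ≤ (κ + t ^ 2) ^ ((p - 2) / 2) * t := by
  rcases hs.eq_or_lt with rfl | hs
  · rw [mul_zero]; positivity
  have ht : 0 < t := hs.trans_le hst
  have hS : 0 < κ + s ^ 2 := by positivity
  have hT : 0 < κ + t ^ 2 := by positivity
  -- For `p < 2` the coefficient `(κ + r²)^((p-2)/2)` itself decreases; in this factorisation both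
  -- factors are nondecreasing.
  have key : ∀ r : ℝ, 0 < κ + r ^ 2 → (κ + r ^ 2) ^ ((p - 2) / 2) * r
      = (κ + r ^ 2) ^ ((p - 1) / 2) * (r / √(κ + r ^ 2)) := by
    intro r hr
    rw [show (p - 2) / 2 = (p - 1) / 2 - 1 / 2 by ring, Real.rpow_sub hr, Real.sqrt_eq_rpow]
    ring
  rw [key s hS, key t hT]
  refine mul_le_mul (Real.rpow_le_rpow hS.le (by gcongr) (by linarith)) ?_ (by positivity)
    (by positivity)
  rw [div_le_div_iff₀ (Real.sqrt_pos.2 hS) (Real.sqrt_pos.2 hT)]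
  refine (pow_le_pow_iff_left₀ (by positivity) (by positivity) two_ne_zero).1 ?_
  rw [mul_pow, mul_pow, Real.sq_sqrt hS.le, Real.sq_sqrt hT.le]
  have : s ^ 2 * κ ≤ t ^ 2 * κ := by gcongr
  linarith

theorem inner_stress_self (A : Mat d) :
    inner ℝ (stress κ p A) A = (κ + ‖A‖ ^ 2) ^ ((p - 2) / 2) * ‖A‖ ^ 2 := by
  rw [stress, inner_smul_left, real_inner_self_eq_norm_sq, conj_trivial]

theorem inner_stress_self_nonneg (hκ : 0 ≤ κ) (A : Mat d) : 0 ≤ inner ℝ (stress κ p A) A := by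
  rw [inner_stress_self]; positivity

theorem eq_zero_of_inner_stress_self (hκ : 0 ≤ κ) {A : Mat d}
    (h : inner ℝ (stress κ p A) A = 0) : A = 0 := by
  by_contra hA
  have := norm_pos_iff.2 hA
  rw [inner_stress_self] at h
  have : 0 < (κ + ‖A‖ ^ 2) ^ ((p - 2) / 2) * ‖A‖ ^ 2 := by positivity
  linarith

/-- Cauchy-Schwarz on the mixed term reduces monotonicity to that of the scalar law in `‖A‖`. -/
theorem stress_mono (hp : 1 < p) (hκ : 0 ≤ κ) (A B : Mat d) :
    0 ≤ inner ℝ (stress κ p A - stress κ p B) (A - B) := by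
  set h : ℝ → ℝ := fun t => (κ + t ^ 2) ^ ((p - 2) / 2) with hh
  have hpos : ∀ t, 0 ≤ h t := fun t => by simp only [hh]; positivity
  have e : inner ℝ (stress κ p A - stress κ p B) (A - B)
      = h ‖A‖ * ‖A‖ ^ 2 + h ‖B‖ * ‖B‖ ^ 2 - (h ‖A‖ + h ‖B‖) * inner ℝ A B := by
    simp only [stress, inner_sub_left, inner_sub_right, inner_smul_left,
      real_inner_self_eq_norm_sq, conj_trivial, real_inner_comm A B, hh]
    ring
  have h1 : (h ‖A‖ + h ‖B‖) * inner ℝ A B ≤ (h ‖A‖ + h ‖B‖) * (‖A‖ * ‖B‖) :=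
    mul_le_mul_of_nonneg_left (real_inner_le_norm A B) (add_nonneg (hpos _) (hpos _))
  have h2 : 0 ≤ (h ‖A‖ * ‖A‖ - h ‖B‖ * ‖B‖) * (‖A‖ - ‖B‖) := by
    rcases le_total ‖A‖ ‖B‖ with hAB | hAB
    · have := powerLaw_mono hp hκ (norm_nonneg A) hAB
      exact mul_nonneg_of_nonpos_of_nonpos (by simp only [hh]; linarith) (by linarith)
    · have := powerLaw_mono hp hκ (norm_nonneg B) hAB
      exact mul_nonneg (by simp only [hh]; linarith) (by linarith)
  rw [e]
  linarith

theorem norm_stress_le (hp : 1 < p) (hκ : 0 ≤ κ) (A : Mat d) :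
    ‖stress κ p A‖ ≤ (√κ + ‖A‖) ^ (p - 1) := by
  rcases eq_or_ne A 0 with rfl | hA
  · rw [stress_zero, norm_zero]; positivity
  have hA' := norm_pos_iff.2 hA
  have hT : 0 < κ + ‖A‖ ^ 2 := by positivity
  have hr : √(κ + ‖A‖ ^ 2) ^ (p - 1) = (κ + ‖A‖ ^ 2) ^ ((p - 2) / 2) * √(κ + ‖A‖ ^ 2) := by
    rw [Real.sqrt_eq_rpow, ← Real.rpow_mul hT.le, ← Real.rpow_add hT]
    congr 1; ring
  have hle : ‖A‖ ≤ √(κ + ‖A‖ ^ 2) := Real.le_sqrt_of_sq_le (by linarith)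
  calc ‖stress κ p A‖ = (κ + ‖A‖ ^ 2) ^ ((p - 2) / 2) * ‖A‖ := by
        rw [stress, norm_smul, Real.norm_of_nonneg (by positivity)]
    _ ≤ (κ + ‖A‖ ^ 2) ^ ((p - 2) / 2) * √(κ + ‖A‖ ^ 2) := by gcongr
    _ = √(κ + ‖A‖ ^ 2) ^ (p - 1) := hr.symm
    _ ≤ (√κ + ‖A‖) ^ (p - 1) := by
        refine Real.rpow_le_rpow (Real.sqrt_nonneg _) ?_ (by linarith)
        refine Real.sqrt_le_iff.2 ⟨by positivity, ?_⟩
        have h1 := Real.sq_sqrt hκ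
        have h2 : 0 ≤ √κ * ‖A‖ := by positivity
        nlinarith

/-- The only delicate point is `A = 0` with `κ = 0`, where the coefficient may be singular; there
the growth bound with exponent `p - 1 > 0` gives the limit. -/
theorem continuous_stress (hp : 1 < p) (hκ : 0 ≤ κ) :
    Continuous (stress κ p : Mat d → Mat d) := by
  rcases hκ.eq_or_lt with rfl | hκ'
  · refine continuous_iff_continuousAt.2 fun A => ?_
    rcases eq_or_ne A 0 with rfl | hA
    · rw [ContinuousAt, stress_zero]
      refine squeeze_zero_norm (norm_stress_le hp le_rfl) ?_
      have : Continuous fun A : Mat d => (√0 + ‖A‖) ^ (p - 1) :=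
        (by fun_prop : Continuous fun A : Mat d => √0 + ‖A‖).rpow_const
          fun _ => Or.inr (by linarith)
      have h := this.tendsto 0
      simpa [Real.zero_rpow (by linarith : p - 1 ≠ 0)] using h
    · refine ContinuousAt.smul (ContinuousAt.rpow_const (by fun_prop) (Or.inl ?_)) continuousAt_id
      have := norm_pos_iff.2 hA
      positivity
  · refine Continuous.smul (Continuous.rpow_const (by fun_prop) fun A => Or.inl ?_) continuous_id
    positivity

/-- The integrand of the viscous form is dominated by a `p`-th power. -/
theorem norm_inner_stress_le (hp : 1 < p) (hκ : 0 ≤ κ) (A B : Mat d) {h : ℝ}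
    (hA : √κ + ‖A‖ ≤ h) (hB : ‖B‖ ≤ h) : ‖inner ℝ (stress κ p A) B‖ ≤ ‖h‖ ^ p := by
  have hh : 0 ≤ h := (norm_nonneg B).trans hB
  rcases hh.eq_or_lt with rfl | hh'
  · have hB0 : B = 0 := norm_le_zero_iff.1 hB
    simp only [hB0, inner_zero_right, norm_zero]
    exact Real.rpow_nonneg le_rfl _
  calc ‖inner ℝ (stress κ p A) B‖ ≤ ‖stress κ p A‖ * ‖B‖ := norm_inner_le_norm _ _
    _ ≤ h ^ (p - 1) * h := by
        refine mul_le_mul ((norm_stress_le hp hκ A).trans ?_) hB (norm_nonneg _) (by positivity)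
        exact Real.rpow_le_rpow (by positivity) hA (by linarith)
    _ = ‖h‖ ^ p := by
        rw [Real.norm_of_nonneg hh]
        nth_rewrite 2 [← Real.rpow_one h]
        rw [← Real.rpow_add hh', sub_add_cancel]

variable {α : Type*} [MeasurableSpace α] {μ : Measure α}

theorem integrable_inner_stress [IsFiniteMeasure μ] (hp : 1 < p) (hκ : 0 ≤ κ) {F G : α → Mat d}
    (hF : MemLp F (ENNReal.ofReal p) μ) (hG : MemLp G (ENNReal.ofReal p) μ) :
    Integrable (fun x => inner ℝ (stress κ p (F x)) (G x)) μ := by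
  have hh : MemLp (fun x => √κ + ‖F x‖ + ‖G x‖) (ENNReal.ofReal p) μ :=
    ((memLp_const (√κ)).add hF.norm).add hG.norm
  have hi := hh.integrable_norm_rpow
    (ENNReal.ofReal_pos.2 (by linarith)).ne' ENNReal.ofReal_ne_top
  rw [ENNReal.toReal_ofReal (by linarith)] at hi
  refine hi.mono' (((continuous_stress hp hκ).comp_aestronglyMeasurable
    hF.aestronglyMeasurable).inner hG.aestronglyMeasurable) (ae_of_all _ fun x => ?_)
  exact norm_inner_stress_le hp hκ _ _ (by linarith [norm_nonneg (G x)])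
    (by linarith [norm_nonneg (F x), Real.sqrt_nonneg κ])

variable {V : Type*} [AddCommGroup V] [Module ℝ V]

/-- The viscous form `(S(ε u), ε ξ)` of a discrete symmetric gradient `ε`. -/
noncomputable def viscousForm [IsFiniteMeasure μ] (hp : 1 < p) (hκ : 0 ≤ κ)
    (ε : V →ₗ[ℝ] Lp (Mat d) (ENNReal.ofReal p) μ) (u : V) : V →ₗ[ℝ] ℝ where
  toFun ξ := ∫ x, inner ℝ (stress κ p (ε u x)) (ε ξ x) ∂μ
  map_add' ξ η := by
    rw [← integral_add (integrable_inner_stress hp hκ (Lp.memLp _) (Lp.memLp _))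
      (integrable_inner_stress hp hκ (Lp.memLp _) (Lp.memLp _))]
    refine integral_congr_ae ?_
    rw [map_add]
    filter_upwards [Lp.coeFn_add (ε ξ) (ε η)] with x hx
    rw [hx, Pi.add_apply, inner_add_right]
  map_smul' c ξ := by
    rw [RingHom.id_apply, smul_eq_mul, ← integral_const_mul]
    refine integral_congr_ae ?_
    rw [map_smul]
    filter_upwards [Lp.coeFn_smul c (ε ξ)] with x hx
    rw [hx, Pi.smul_apply, inner_smul_right]

variable [IsFiniteMeasure μ] (hp : 1 < p) (hκ : 0 ≤ κ)
  (ε : V →ₗ[ℝ] Lp (Mat d) (ENNReal.ofReal p) μ)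

theorem viscousForm_apply (u ξ : V) :
    viscousForm hp hκ ε u ξ = ∫ x, inner ℝ (stress κ p (ε u x)) (ε ξ x) ∂μ := rfl

theorem viscousForm_zero : viscousForm hp hκ ε 0 = 0 := by
  ext ξ
  rw [viscousForm_apply, map_zero, LinearMap.zero_apply]
  refine integral_eq_zero_of_ae ?_
  filter_upwards [Lp.coeFn_zero (Mat d) (ENNReal.ofReal p) μ] with x hx
  rw [hx, Pi.zero_apply, stress_zero, inner_zero_left, Pi.zero_apply]

theorem viscousForm_mono (u v : V) :
    0 ≤ viscousForm hp hκ ε u (u - v) - viscousForm hp hκ ε v (u - v) := by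
  rw [viscousForm_apply, viscousForm_apply,
    ← integral_sub (integrable_inner_stress hp hκ (Lp.memLp _) (Lp.memLp _))
      (integrable_inner_stress hp hκ (Lp.memLp _) (Lp.memLp _)), map_sub]
  refine integral_nonneg_of_ae ?_
  filter_upwards [Lp.coeFn_sub (ε u) (ε v)] with x hx
  rw [hx, Pi.sub_apply, ← inner_sub_left]
  exact stress_mono hp hκ _ _

theorem viscousForm_pos (hε : Function.Injective ε) {u : V} (hu : u ≠ 0) :
    0 < viscousForm hp hκ ε u u := by
  have hnn : 0 ≤ fun x => inner ℝ (stress κ p (ε u x)) (ε u x) :=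
    fun x => inner_stress_self_nonneg hκ _
  refine lt_of_le_of_ne (integral_nonneg hnn) fun h => hu (hε ?_)
  have h0 := (integral_eq_zero_iff_of_nonneg hnn
    (integrable_inner_stress hp hκ (Lp.memLp (ε u)) (Lp.memLp (ε u)))).1 h.symm
  rw [map_zero, Lp.eq_zero_iff_ae_eq_zero]
  filter_upwards [h0] with x hx
  exact eq_zero_of_inner_stress_self hκ hx

/-- Dominated convergence needs representatives depending continuously on `u` at each point, which
`Lp` classes do not provide. Expanding `u` in a basis with fixed representatives of the `ε (b i)`
supplies them. -/
theorem continuous_viscousForm {V : Type*} [NormedAddCommGroup V] [InnerProductSpace ℝ V]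
    [FiniteDimensional ℝ V] (ε : V →ₗ[ℝ] Lp (Mat d) (ENNReal.ofReal p) μ) (ξ : V) : Continuous fun u => viscousForm hp hκ ε u ξ := by
  let b := stdOrthonormalBasis ℝ V
  let A : V → α → Mat d := fun u x => ∑ i, inner ℝ (b i) u • ε (b i) x
  have hA : ∀ u, ε u =ᵐ[μ] A u := by
    intro u
    have h1 : ε u = ∑ i, inner ℝ (b i) u • ε (b i) := by
      conv_lhs => rw [← b.sum_repr' u]
      rw [map_sum]; simp only [map_smul]
    rw [h1]
    refine (Lp.coeFn_finsetSum _ _).trans ?_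
    have : ∀ᵐ x ∂μ, ∀ i, (inner ℝ (b i) u • ε (b i)) x = inner ℝ (b i) u • ε (b i) x :=
      ae_all_iff.2 fun i => Lp.coeFn_smul _ _
    filter_upwards [this] with x hx
    simp [A, hx]
  have hform : (fun u => viscousForm hp hκ ε u ξ)
      = fun u => ∫ x, inner ℝ (stress κ p (A u x)) (ε ξ x) ∂μ := by
    ext u
    refine integral_congr_ae ?_
    filter_upwards [hA u] with x hx
    rw [hx]
  rw [hform]
  refine continuous_iff_continuousAt.2 fun u₀ => ?_
  let h : α → ℝ := fun x => √κ + (‖u₀‖ + 1) * ∑ i, ‖ε (b i) x‖ + ‖ε ξ x‖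
  have hsum : MemLp (fun x => ∑ i, ‖ε (b i) x‖) (ENNReal.ofReal p) μ :=
    memLp_finsetSum _ fun i _ => (Lp.memLp (ε (b i))).norm
  have hh : MemLp h (ENNReal.ofReal p) μ :=
    ((memLp_const (√κ)).add (hsum.const_mul (‖u₀‖ + 1))).add (Lp.memLp (ε ξ)).norm
  have hi := hh.integrable_norm_rpow
    (ENNReal.ofReal_pos.2 (by linarith)).ne' ENNReal.ofReal_ne_top
  rw [ENNReal.toReal_ofReal (by linarith)] at hi
  refine continuousAt_of_dominated (bound := fun x => ‖h x‖ ^ p) ?_ ?_ hi ?_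
  · refine Eventually.of_forall fun u => ?_
    exact (((continuous_stress hp hκ).comp_aestronglyMeasurable
      ((Lp.aestronglyMeasurable (ε u)).congr (hA u))).inner (Lp.aestronglyMeasurable _))
  · filter_upwards [Metric.ball_mem_nhds u₀ one_pos] with u hu
    refine ae_of_all _ fun x => ?_
    have hun : ‖u‖ ≤ ‖u₀‖ + 1 := by
      have h1 := norm_le_norm_add_norm_sub' u u₀
      have h2 : ‖u - u₀‖ < 1 := by simpa [dist_eq_norm] using hu
      linarith
    have hAn : ‖A u x‖ ≤ (‖u₀‖ + 1) * ∑ i, ‖ε (b i) x‖ := by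
      rw [Finset.mul_sum]
      refine (norm_sum_le _ _).trans (Finset.sum_le_sum fun i _ => ?_)
      rw [norm_smul]
      refine mul_le_mul_of_nonneg_right (le_trans ?_ hun) (norm_nonneg _)
      have := norm_inner_le_norm (𝕜 := ℝ) (b i) u
      rwa [b.norm_eq_one, one_mul] at this
    refine norm_inner_stress_le hp hκ _ _ ?_ ?_
    · simp only [h]; linarith [norm_nonneg (ε ξ x)]
    · simp only [h]
      have : 0 ≤ (‖u₀‖ + 1) * ∑ i, ‖ε (b i) x‖ :=
        mul_nonneg (by positivity) (Finset.sum_nonneg fun i _ => norm_nonneg _)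
      linarith [Real.sqrt_nonneg κ]
  · refine ae_of_all _ fun x => ?_
    have : Continuous fun u => A u x := by simp only [A]; fun_prop
    exact ((((continuous_stress hp hκ).comp this).inner continuous_const)).continuousAt

end Stress

end StochStokes

namespace StochStokes

/-! ### Integrability of the transport term -/

section RowMul

variable {d : ℕ}

theorem rowMul_add (s : Vec d) (G H : Mat d) : rowMul s (G + H) = rowMul s G + rowMul s H := by
  ext i
  simp [rowMul, mul_add, Finset.sum_add_distrib]

theorem rowMul_smul (s : Vec d) (c : ℝ) (G : Mat d) : rowMul s (c • G) = c • rowMul s G := by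
  ext i
  simp only [rowMul, PiLp.smul_apply, smul_eq_mul, Finset.mul_sum]
  exact Finset.sum_congr rfl fun j _ => by ring

theorem norm_rowMul_le (s : Vec d) (G : Mat d) : ‖rowMul s G‖ ≤ ‖s‖ * ‖G‖ := by
  refine (pow_le_pow_iff_left₀ (norm_nonneg _) (by positivity) two_ne_zero).1 ?_
  rw [mul_pow, EuclideanSpace.real_norm_sq_eq, EuclideanSpace.real_norm_sq_eq s,
    EuclideanSpace.real_norm_sq_eq G, Fintype.sum_prod_type_right, Finset.mul_sum]
  exact Finset.sum_le_sum fun i _ =>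
    Finset.sum_mul_sq_le_sq_mul_sq Finset.univ (fun j => s j) fun j => G (j, i)

theorem continuous_rowMul : Continuous fun z : Vec d × Mat d => rowMul z.1 z.2 :=
  (PiLp.continuous_toLp 2 _).comp (continuous_pi fun i => by fun_prop)

variable {α : Type*} [MeasurableSpace α] {μ : Measure α}

theorem MemLp.rowMul {σ : α → Vec d} (hσ : MemLp σ ∞ μ) {F : α → Mat d} {r : ℝ≥0∞}
    (hF : MemLp F r μ) : MemLp (fun x => rowMul (σ x) (F x)) r μ := by
  refine hF.of_le_mul (c := (eLpNormEssSup σ μ).toReal)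
    (continuous_rowMul.comp_aestronglyMeasurable
      (hσ.aestronglyMeasurable.prodMk hF.aestronglyMeasurable)) ?_
  have hfin : eLpNormEssSup σ μ ≠ ∞ := by
    have := hσ.eLpNorm_ne_top
    rwa [eLpNorm_exponent_top] at this
  filter_upwards [enorm_ae_le_eLpNormEssSup σ μ] with x hx
  refine (norm_rowMul_le _ _).trans (mul_le_mul_of_nonneg_right ?_ (norm_nonneg _))
  have := ENNReal.toReal_mono hfin hx
  rwa [toReal_enorm] at this

theorem symGrad_zero (x : Vec d) : symGrad (0 : Vec d → Vec d) x = 0 := by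
  ext i
  simp [symGrad]

end RowMul

section Holder

variable {α : Type*} [MeasurableSpace α] {μ : Measure α} {p : ℝ}

theorem holderConjugate_ofReal (hp : 1 < p) :
    (ENNReal.ofReal p).HolderConjugate (ENNReal.ofReal (p / (p - 1))) :=
  (Real.HolderConjugate.conjExponent hp).ennrealOfReal

theorem integrable_mul_of_holder (hp : 1 < p) {f h : α → ℝ} (hf : MemLp f (ENNReal.ofReal p) μ)
    (hh : MemLp h (ENNReal.ofReal (p / (p - 1))) μ) : Integrable (fun x => f x * h x) μ :=
  have := holderConjugate_ofReal hp
  hf.integrable_mul hh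

theorem integrable_inner_of_holder {F : Type*} [NormedAddCommGroup F] [InnerProductSpace ℝ F]
    (hp : 1 < p) {f h : α → F} (hf : MemLp f (ENNReal.ofReal p) μ)
    (hh : MemLp h (ENNReal.ofReal (p / (p - 1))) μ) :
    Integrable (fun x => (inner ℝ (f x) (h x) : ℝ)) μ :=
  (integrable_mul_of_holder hp hf.norm hh.norm).mono'
    (hf.aestronglyMeasurable.inner hh.aestronglyMeasurable)
    (ae_of_all _ fun _ => norm_inner_le_norm _ _)

end Holder

/-! ### Elimination of the pressure -/

namespace GradientDiscretisation

variable {d : ℕ} {O : Set (Vec d)} {p κ : ℝ} {X Y : Type*}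
  [AddCommGroup X] [Module ℝ X] [FiniteDimensional ℝ X]
  [AddCommGroup Y] [Module ℝ Y] [FiniteDimensional ℝ Y]
  {D : GradientDiscretisation O p X Y} {Γ : ℝ}

/-- An infinite numerator over a finite denominator would make the supremum infinite. This is how
stability supplies integrability at the conjugate exponent. -/
theorem eLpNorm_sum_ne_top {r : ℝ} (hC : D.coercivityConst r ≠ ∞) {v : X}
    (hv : MemLp (D.eps v) (ENNReal.ofReal r) (volume.restrict O)) :
    eLpNorm (D.vel v) (ENNReal.ofReal r) (volume.restrict O)
      + eLpNorm (D.dvg v) (ENNReal.ofReal r) (volume.restrict O)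
      + eLpNorm (D.grad v) (ENNReal.ofReal r) (volume.restrict O) ≠ ∞ := by
  intro h
  have := le_iSup (fun v : X =>
    (eLpNorm (D.vel v) (ENNReal.ofReal r) (volume.restrict O)
      + eLpNorm (D.dvg v) (ENNReal.ofReal r) (volume.restrict O)
      + eLpNorm (D.grad v) (ENNReal.ofReal r) (volume.restrict O))
    / eLpNorm (D.eps v) (ENNReal.ofReal r) (volume.restrict O)) v
  simp only [h, ENNReal.top_div_of_ne_top hv.eLpNorm_ne_top, top_le_iff] at this
  exact hC this

theorem IsStable.coercivityConst_ne_top (hD : D.IsStable Γ) :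
    D.coercivityConst (p / (p - 1)) ≠ ∞ :=
  ne_top_of_le_ne_top ENNReal.ofReal_ne_top (le_add_self.trans hD.coercivity)

theorem IsStable.memLp_vel (hD : D.IsStable Γ) (v : X) :
    MemLp (D.vel v) (ENNReal.ofReal (p / (p - 1))) (volume.restrict O) := by
  have := eLpNorm_sum_ne_top hD.coercivityConst_ne_top (hD.eps_memLp v)
  simp only [ne_eq, ENNReal.add_eq_top, not_or] at this
  exact ⟨Lp.aestronglyMeasurable _, lt_top_iff_ne_top.2 this.1.1⟩

theorem IsStable.memLp_dvg (hD : D.IsStable Γ) (v : X) :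
    MemLp (D.dvg v) (ENNReal.ofReal (p / (p - 1))) (volume.restrict O) := by
  have := eLpNorm_sum_ne_top hD.coercivityConst_ne_top (hD.eps_memLp v)
  simp only [ne_eq, ENNReal.add_eq_top, not_or] at this
  exact ⟨Lp.aestronglyMeasurable _, lt_top_iff_ne_top.2 this.1.2⟩

/-- The transport form `(σᵀ ∇ v, Π ξ)`. -/
noncomputable def transportForm (hD : D.IsStable Γ) (hp : 1 < p) {σ : Vec d → Vec d}
    (hσ : MemLp σ ∞ (volume.restrict O)) : X →ₗ[ℝ] X →ₗ[ℝ] ℝ :=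
  have hi : ∀ v ξ, Integrable (fun x => (inner ℝ (rowMul (σ x) (D.grad v x)) (D.vel ξ x) : ℝ))
      (volume.restrict O) := fun v ξ =>
    integrable_inner_of_holder hp (MemLp.rowMul hσ (Lp.memLp _)) (hD.memLp_vel ξ)
  LinearMap.mk₂ ℝ (fun v ξ => ∫ x in O, inner ℝ (rowMul (σ x) (D.grad v x)) (D.vel ξ x))
    (fun v w ξ => by
      rw [← integral_add (hi v ξ) (hi w ξ)]
      refine integral_congr_ae ?_
      rw [map_add]
      filter_upwards [Lp.coeFn_add (D.grad v) (D.grad w)] with x hx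
      rw [hx, Pi.add_apply, rowMul_add, inner_add_left])
    (fun c v ξ => by
      rw [smul_eq_mul, ← integral_const_mul]
      refine integral_congr_ae ?_
      rw [map_smul]
      filter_upwards [Lp.coeFn_smul c (D.grad v)] with x hx
      rw [hx, Pi.smul_apply, rowMul_smul, inner_smul_left, conj_trivial])
    (fun v ξ η => by
      rw [← integral_add (hi v ξ) (hi v η)]
      refine integral_congr_ae ?_
      rw [map_add]
      filter_upwards [Lp.coeFn_add (D.vel ξ) (D.vel η)] with x hx
      rw [hx, Pi.add_apply, inner_add_right])
    (fun c v ξ => by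
      rw [smul_eq_mul, ← integral_const_mul]
      refine integral_congr_ae ?_
      rw [map_smul]
      filter_upwards [Lp.coeFn_smul c (D.vel ξ)] with x hx
      rw [hx, Pi.smul_apply, inner_smul_right])

/-- The noise form as a bilinear map. -/
noncomputable def noiseBilin (hD : D.IsStable Γ) (hp : 1 < p) {σ : Vec d → Vec d}
    (hσ : MemLp σ ∞ (volume.restrict O)) : X →ₗ[ℝ] X →ₗ[ℝ] ℝ :=
  (1 / 2 : ℝ) • transportForm hD hp hσ - (1 / 2 : ℝ) • (transportForm hD hp hσ).flip

theorem noiseBilin_apply (hD : D.IsStable Γ) (hp : 1 < p) {σ : Vec d → Vec d}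
    (hσ : MemLp σ ∞ (volume.restrict O)) (v ξ : X) :
    noiseBilin hD hp hσ v ξ = D.noiseForm σ v ξ := by
  simp only [noiseForm, real_inner_comm (rowMul _ _) (D.vel v _)]
  rfl

theorem noiseBilin_self (hD : D.IsStable Γ) (hp : 1 < p) {σ : Vec d → Vec d}
    (hσ : MemLp σ ∞ (volume.restrict O)) (v : X) : noiseBilin hD hp hσ v v = 0 := by
  simp [noiseBilin]

variable [IsFiniteMeasure (volume.restrict O)]

/-- The divergence lies in both `L^p` and `L^(p')`, so it can be paired with a pressure known only
at the smaller of the two exponents. -/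
theorem IsStable.integrable_chi_mul_dvg (hD : D.IsStable Γ) (hp : 1 < p) (q : Y) (v : X) :
    Integrable (fun x => D.chi q x * D.dvg v x) (volume.restrict O) := by
  rcases le_total p (p / (p - 1)) with h | h
  · exact integrable_mul_of_holder hp
      ((Lp.memLp (D.chi q)).mono_exponent (by rw [min_eq_left h])) (hD.memLp_dvg v)
  · have := integrable_mul_of_holder hp (Lp.memLp (D.dvg v))
      ((Lp.memLp (D.chi q)).mono_exponent (by rw [min_eq_right h]))
    exact this.congr (ae_of_all _ fun x => mul_comm _ _)

theorem integrable_chi (hp : 1 < p) (q : Y) : Integrable (D.chi q) (volume.restrict O) := by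
  refine (Lp.memLp (D.chi q)).integrable (ENNReal.one_le_ofReal.2 (le_min hp.le ?_))
  rw [le_div_iff₀ (by linarith)]
  linarith

variable (D) in
/-- The space of discrete pressures with vanishing mean value. -/
noncomputable def meanFree (hp : 1 < p) : Submodule ℝ Y where
  carrier := D.Y₀
  zero_mem' := by
    refine integral_eq_zero_of_ae ?_
    rw [map_zero]
    exact Lp.coeFn_zero _ _ _
  add_mem' {q r} hq hr := by
    have hq' : ∫ x in O, D.chi q x = 0 := hq
    have hr' : ∫ x in O, D.chi r x = 0 := hr
    change ∫ x in O, D.chi (q + r) x = 0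
    rw [map_add, integral_congr_ae (Lp.coeFn_add (D.chi q) (D.chi r)),
      integral_add' (integrable_chi hp q) (integrable_chi hp r), hq', hr', add_zero]
  smul_mem' c q hq := by
    have hq' : ∫ x in O, D.chi q x = 0 := hq
    change ∫ x in O, D.chi (c • q) x = 0
    rw [map_smul, integral_congr_ae (Lp.coeFn_smul c (D.chi q))]
    simp only [Pi.smul_apply]
    rw [integral_smul, hq', smul_zero]

theorem mem_meanFree (hp : 1 < p) {q : Y} : q ∈ D.meanFree hp ↔ q ∈ D.Y₀ := Iff.rfl

/-- The pressure-divergence pairing `(χ q, div v)`. -/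
noncomputable def pressureForm (hD : D.IsStable Γ) (hp : 1 < p) : Y →ₗ[ℝ] X →ₗ[ℝ] ℝ :=
  LinearMap.mk₂ ℝ (fun q v => ∫ x in O, D.chi q x * D.dvg v x)
    (fun q r v => by
      rw [← integral_add (hD.integrable_chi_mul_dvg hp q v) (hD.integrable_chi_mul_dvg hp r v)]
      refine integral_congr_ae ?_
      rw [map_add]
      filter_upwards [Lp.coeFn_add (D.chi q) (D.chi r)] with x hx
      rw [hx, Pi.add_apply, add_mul])
    (fun c q v => by
      rw [smul_eq_mul, ← integral_const_mul]
      refine integral_congr_ae ?_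
      rw [map_smul]
      filter_upwards [Lp.coeFn_smul c (D.chi q)] with x hx
      rw [hx, Pi.smul_apply, smul_eq_mul, mul_assoc])
    (fun q v w => by
      rw [← integral_add (hD.integrable_chi_mul_dvg hp q v) (hD.integrable_chi_mul_dvg hp q w)]
      refine integral_congr_ae ?_
      rw [map_add]
      filter_upwards [Lp.coeFn_add (D.dvg v) (D.dvg w)] with x hx
      rw [hx, Pi.add_apply, mul_add])
    (fun c q v => by
      rw [smul_eq_mul, ← integral_const_mul]
      refine integral_congr_ae ?_
      rw [map_smul]
      filter_upwards [Lp.coeFn_smul c (D.dvg v)] with x hx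
      rw [hx, Pi.smul_apply, smul_eq_mul]; ring)

theorem pressureForm_apply (hD : D.IsStable Γ) (hp : 1 < p) (q : Y) (v : X) :
    pressureForm hD hp q v = ∫ x in O, D.chi q x * D.dvg v x := rfl

/-- The difference of two pressures, paired with a divergence. -/
theorem integral_sub_chi_mul_dvg (hD : D.IsStable Γ) (hp : 1 < p) (q r : Y) (v : X) :
    ∫ x in O, (D.chi q x - D.chi r x) * D.dvg v x = pressureForm hD hp (q - r) v := by
  rw [map_sub, LinearMap.sub_apply, pressureForm_apply, pressureForm_apply,
    ← integral_sub (hD.integrable_chi_mul_dvg hp q v) (hD.integrable_chi_mul_dvg hp r v)]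
  simp only [sub_mul]

/-- The discretely divergence-free velocities. -/
noncomputable def divFree (hD : D.IsStable Γ) (hp : 1 < p) : Submodule ℝ X :=
  ((D.meanFree hp).map (pressureForm hD hp)).dualCoannihilator

theorem mem_divFree (hD : D.IsStable Γ) (hp : 1 < p) {v : X} :
    v ∈ divFree hD hp ↔ ∀ q ∈ D.Y₀, pressureForm hD hp q v = 0 := by
  simp [divFree, Submodule.mem_dualCoannihilator, mem_meanFree]

theorem mem_divFree_iff_integral (hD : D.IsStable Γ) (hp : 1 < p) {v : X} :
    v ∈ divFree hD hp ↔ ∀ q ∈ D.Y₀, ∫ x in O, D.dvg v x * D.chi q x = 0 := by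
  simp only [mem_divFree, pressureForm_apply, mul_comm (D.dvg v _)]

/-- A functional that vanishes on the divergence-free velocities is a discrete pressure. -/
theorem exists_pressure (hD : D.IsStable Γ) (hp : 1 < p) (f : X →ₗ[ℝ] ℝ)
    (hf : ∀ ξ ∈ divFree hD hp, f ξ = 0) : ∃ q ∈ D.Y₀, ∀ ξ, pressureForm hD hp q ξ = f ξ := by
  have : f ∈ (divFree hD hp).dualAnnihilator := (Submodule.mem_dualAnnihilator f).2 hf
  -- In finite dimension the annihilator of the coannihilator of a space of functionals is that
  -- space, here the functionals induced by mean-free pressures. No inf-sup bound enters.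
  rw [divFree, Subspace.dualCoannihilator_dualAnnihilator_eq, Submodule.mem_map] at this
  obtain ⟨q, hq, h⟩ := this
  exact ⟨q, hq, fun ξ => by rw [h]⟩

theorem vel_domRestrict_injective (hD : D.IsStable Γ) (hp : 1 < p) :
    Function.Injective (D.vel.domRestrict (divFree hD hp)) := by
  intro v w h
  exact Subtype.ext (D.vel_injOn ((mem_divFree hD hp).1 v.2) ((mem_divFree hD hp).1 w.2) h)

/-- The reconstructions of the divergence-free velocities. -/
noncomputable abbrev velSpace (hD : D.IsStable Γ) (hp : 1 < p) : Submodule ℝ (L2 O) :=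
  LinearMap.range (D.vel.domRestrict (divFree hD hp))

/-- The divergence-free discrete velocity with a given reconstruction. -/
noncomputable def lift (hD : D.IsStable Γ) (hp : 1 < p) : velSpace hD hp →ₗ[ℝ] X :=
  (divFree hD hp).subtype ∘ₗ
    (LinearEquiv.ofInjective _ (vel_domRestrict_injective hD hp)).symm.toLinearMap

theorem lift_mem (hD : D.IsStable Γ) (hp : 1 < p) (u : velSpace hD hp) :
    lift hD hp u ∈ divFree hD hp := Subtype.property _

theorem vel_lift (hD : D.IsStable Γ) (hp : 1 < p) (u : velSpace hD hp) :
    D.vel (lift hD hp u) = u := by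
  have := (LinearEquiv.ofInjective _ (vel_domRestrict_injective hD hp)).apply_symm_apply u
  exact congrArg Subtype.val this

theorem lift_injective (hD : D.IsStable Γ) (hp : 1 < p) : Function.Injective (lift hD hp) := by
  intro u w h
  exact Subtype.ext (by rw [← vel_lift hD hp u, h, vel_lift])

theorem exists_lift_eq (hD : D.IsStable Γ) (hp : 1 < p) {v : X} (hv : v ∈ divFree hD hp) :
    ∃ u, lift hD hp u = v := by
  refine ⟨⟨D.vel v, ⟨v, hv⟩, rfl⟩, ?_⟩
  exact D.vel_injOn ((mem_divFree hD hp).1 (lift_mem hD hp _)) ((mem_divFree hD hp).1 hv)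
    (vel_lift hD hp _)

/-- The viscous form on divergence-free reconstructions. -/
noncomputable def drift (hD : D.IsStable Γ) (hp : 1 < p) (hκ : 0 ≤ κ) :
    velSpace hD hp → velSpace hD hp →ₗ[ℝ] ℝ :=
  viscousForm hp hκ (D.eps ∘ₗ lift hD hp)

/-- The noise form on divergence-free reconstructions. -/
noncomputable def noise (hD : D.IsStable Γ) (hp : 1 < p) {σ : Vec d → Vec d}
    (hσ : MemLp σ ∞ (volume.restrict O)) :
    velSpace hD hp →ₗ[ℝ] velSpace hD hp →ₗ[ℝ] ℝ :=
  (noiseBilin hD hp hσ).compl₁₂ (lift hD hp) (lift hD hp)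

theorem isDissipative (hD : D.IsStable Γ) (hp : 1 < p) (hκ : 0 ≤ κ) {σ : Vec d → Vec d}
    (hσ : MemLp σ ∞ (volume.restrict O)) :
    IsDissipative (drift hD hp hκ) (noise hD hp hσ) where
  mono := viscousForm_mono hp hκ _
  cont := continuous_viscousForm hp hκ _
  zero := viscousForm_zero hp hκ _
  pos _ hu := viscousForm_pos hp hκ (D.eps ∘ₗ lift hD hp)
    (fun _ _ h => lift_injective hD hp (D.eps_injective h)) hu
  skew _ := noiseBilin_self hD hp hσ _

end GradientDiscretisation

end StochStokes

namespace StochStokes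

/-! ### The scheme as a midpoint rule on reconstructed divergence-free fields -/

namespace GradientDiscretisation

variable {d : ℕ} {O : Set (Vec d)} {p κ τ : ℝ} {X Y : Type*}
  [AddCommGroup X] [Module ℝ X] [FiniteDimensional ℝ X]
  [AddCommGroup Y] [Module ℝ Y] [FiniteDimensional ℝ Y]
  {D : GradientDiscretisation O p X Y} {Γ : ℝ} {σ : Vec d → Vec d}
  [IsFiniteMeasure (volume.restrict O)]

/-- The velocity reconstructs the orthogonal projection of `vin`; the projection error annihilates
divergence-free fields and is therefore a pressure. -/
theorem exists_isInitial (hD : D.IsStable Γ) (hp : 1 < p) (vin : L2 O) :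
    ∃ z, D.IsInitial vin z := by
  set u := (velSpace hD hp).orthogonalProjectionOnto vin with hu
  let f : X →ₗ[ℝ] ℝ := (innerₗ (L2 O) (vin - u)) ∘ₗ D.vel
  obtain ⟨q, hq, hqf⟩ := exists_pressure hD hp f fun ξ hξ => by
    have : D.vel ξ ∈ velSpace hD hp := ⟨⟨ξ, hξ⟩, rfl⟩
    exact Submodule.starProjection_inner_eq_zero vin _ this
  refine ⟨(lift hD hp u, q), hq, fun ξ => ?_, ?_⟩
  · have := hqf ξ
    rw [pressureForm_apply] at this
    simp only [this, vel_lift, f, LinearMap.comp_apply, innerₗ_apply_apply, inner_sub_left]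
    ring
  · exact (mem_divFree_iff_integral hD hp).1 (lift_mem hD hp u)

theorem IsInitial.fst_eq (hD : D.IsStable Γ) (hp : 1 < p) {vin : L2 O} {z : X × Y}
    (hz : D.IsInitial vin z) :
    z.1 = lift hD hp ((velSpace hD hp).orthogonalProjectionOnto vin) := by
  obtain ⟨hq, h, hdiv⟩ := hz
  obtain ⟨u, hu⟩ := exists_lift_eq hD hp ((mem_divFree_iff_integral hD hp).2 hdiv)
  rw [← hu]
  congr 1
  refine Subtype.ext (Submodule.eq_starProjection_of_mem_of_inner_eq_zero u.2 ?_).symm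
  rintro _ ⟨ξ, rfl⟩
  have h1 := h ξ
  have h2 := (mem_divFree hD hp).1 ξ.2 _ hq
  rw [pressureForm_apply] at h2
  rw [h2, add_zero, ← hu, vel_lift] at h1
  rw [inner_sub_left, LinearMap.domRestrict_apply, h1, sub_self]

/-- With trivial boundary values, a Crank-Nicolson step is a residual equation. -/
theorem isStep_zero_iff (hD : D.IsStable Γ) (hp : 1 < p) (hκ : 0 ≤ κ)
    (hσ : MemLp σ ∞ (volume.restrict O)) {c : ℝ} {z z' : X × Y} :
    D.IsStep κ τ 0 σ c z z' ↔ z'.2 ∈ D.Y₀ ∧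
      (∀ ξ, inner ℝ (D.vel z'.1 - D.vel z.1) (D.vel ξ)
        + τ * viscousForm hp hκ D.eps ((1 / 2 : ℝ) • (z'.1 + z.1)) ξ
        - pressureForm hD hp (z'.2 - z.2) ξ
        = noiseBilin hD hp hσ ((1 / 2 : ℝ) • (z'.1 + z.1)) ξ * c) ∧
      (1 / 2 : ℝ) • (z'.1 + z.1) ∈ divFree hD hp := by
  have h0 : ∀ (x : Vec d) (y : Vec d), fderiv ℝ (0 : Vec d → Vec d) x y = 0 := by simp
  simp only [IsStep, symGrad_zero, add_zero, h0, inner_zero_left, integral_zero,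
    integral_sub_chi_mul_dvg hD hp, noiseBilin_apply, mem_divFree_iff_integral,
    viscousForm_apply]

theorem exists_isStep (hD : D.IsStable Γ) (hp : 1 < p) (hκ : 0 ≤ κ)
    (hσ : MemLp σ ∞ (volume.restrict O)) {c : ℝ} {z : X × Y} (hz : z.2 ∈ D.Y₀)
    {u u' : velSpace hD hp} (hzu : z.1 = lift hD hp u)
    (hu : IsMidpointStep τ (drift hD hp hκ) (noise hD hp hσ) c u u') :
    ∃ z', D.IsStep κ τ 0 σ c z z' := by
  set w : X := (1 / 2 : ℝ) • (lift hD hp u' + lift hD hp u) with hw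
  have hw' : w = lift hD hp ((1 / 2 : ℝ) • (u' + u)) := by rw [map_smul, map_add]
  -- The residual of the momentum equation without pressure. The midpoint equation says that it
  -- vanishes on divergence-free fields, so it is represented by the pressure increment.
  let f : X →ₗ[ℝ] ℝ := (innerₗ (L2 O) ((u' : L2 O) - u)) ∘ₗ D.vel + τ • viscousForm hp hκ D.eps w
    - c • noiseBilin hD hp hσ w
  obtain ⟨q, hq, hqf⟩ := exists_pressure hD hp f fun ξ hξ => by
    obtain ⟨η, rfl⟩ := exists_lift_eq hD hp hξ
    have := hu η
    simp only [f, hw', LinearMap.sub_apply, LinearMap.add_apply, LinearMap.smul_apply,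
      LinearMap.comp_apply, innerₗ_apply_apply, vel_lift, smul_eq_mul]
    rw [sub_eq_zero, mul_comm c]
    exact this
  refine ⟨(lift hD hp u', q + z.2), (isStep_zero_iff hD hp hκ hσ).2
    ⟨(D.meanFree hp).add_mem hq hz, fun ξ => ?_, ?_⟩⟩
  · simp only [hzu, vel_lift, add_sub_cancel_right, hqf, ← hw, f, LinearMap.sub_apply,
      LinearMap.add_apply, LinearMap.smul_apply, LinearMap.comp_apply, innerₗ_apply_apply,
      smul_eq_mul]
    ring
  · simp only [hzu, ← hw, hw']
    exact lift_mem hD hp _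

theorem IsStep.exists_midpointStep (hD : D.IsStable Γ) (hp : 1 < p) (hκ : 0 ≤ κ)
    (hσ : MemLp σ ∞ (volume.restrict O)) {c : ℝ} {z z' : X × Y} (hz : z.2 ∈ D.Y₀)
    {u : velSpace hD hp} (hzu : z.1 = lift hD hp u) (h : D.IsStep κ τ 0 σ c z z') :
    ∃ u', z'.1 = lift hD hp u' ∧
      IsMidpointStep τ (drift hD hp hκ) (noise hD hp hσ) c u u' := by
  obtain ⟨hq, heq, hdiv⟩ := (isStep_zero_iff hD hp hκ hσ).1 h
  have hmem : z'.1 ∈ divFree hD hp := by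
    -- The scheme constrains only the midpoint; the new velocity inherits the constraint from it and
    -- the old one.
    have e : z'.1 = (2 : ℝ) • ((1 / 2 : ℝ) • (z'.1 + z.1)) - z.1 := by module
    rw [e]
    exact sub_mem (Submodule.smul_mem _ _ hdiv) (hzu ▸ lift_mem hD hp u)
  obtain ⟨u', hu'⟩ := exists_lift_eq hD hp hmem
  refine ⟨u', hu'.symm, fun ξ => ?_⟩
  have h1 := heq (lift hD hp ξ)
  rw [(mem_divFree hD hp).1 (lift_mem hD hp ξ) _ ((D.meanFree hp).sub_mem hq hz), sub_zero, hzu,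
    ← hu', vel_lift, vel_lift, vel_lift, ← map_add, ← map_smul] at h1
  exact h1

/-- The midpoint step on divergence-free reconstructions, as a map. -/
noncomputable def stepMap (hD : D.IsStable Γ) (hp : 1 < p) (hκ : 0 ≤ κ)
    (hσ : MemLp σ ∞ (volume.restrict O)) (hτ : 0 ≤ τ) (z : velSpace hD hp × ℝ) :
    velSpace hD hp :=
  ((isDissipative hD hp hκ hσ).exists_step hτ z.2 z.1).choose

theorem stepMap_spec (hD : D.IsStable Γ) (hp : 1 < p) (hκ : 0 ≤ κ)
    (hσ : MemLp σ ∞ (volume.restrict O)) (hτ : 0 ≤ τ) (z : velSpace hD hp × ℝ) :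
    IsMidpointStep τ (drift hD hp hκ) (noise hD hp hσ) z.2 z.1 (stepMap hD hp hκ hσ hτ z) :=
  ((isDissipative hD hp hκ hσ).exists_step hτ z.2 z.1).choose_spec

theorem continuous_stepMap (hD : D.IsStable Γ) (hp : 1 < p) (hκ : 0 ≤ κ)
    (hσ : MemLp σ ∞ (volume.restrict O)) (hτ : 0 ≤ τ) : Continuous (stepMap hD hp hκ hσ hτ) :=
  (isDissipative hD hp hκ hσ).continuous_step hτ (stepMap_spec hD hp hκ hσ hτ)

/-- The sequence of reconstructions generated by the midpoint steps. -/
noncomputable def path (hD : D.IsStable Γ) (hp : 1 < p) (hκ : 0 ≤ κ)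
    (hσ : MemLp σ ∞ (volume.restrict O)) (hτ : 0 ≤ τ) (vin : L2 O) (dW : ℕ → ℝ) :
    ℕ → velSpace hD hp
  | 0 => (velSpace hD hp).orthogonalProjectionOnto vin
  | n + 1 => stepMap hD hp hκ hσ hτ (path hD hp hκ hσ hτ vin dW n, dW n)

/-- Existence makes the `Classical.epsilon` choices genuine solutions, and uniqueness of the
midpoint step fixes their velocity. Of the pressure, the induction only needs that it is mean-free.
-/
theorem trajectory_spec (hD : D.IsStable Γ) (hp : 1 < p) (hκ : 0 ≤ κ)
    (hσ : MemLp σ ∞ (volume.restrict O)) (hτ : 0 ≤ τ) (vin : L2 O) (dW : ℕ → ℝ) (n : ℕ) :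
    (D.trajectory κ τ 0 σ vin dW n).2 ∈ D.Y₀ ∧
      (D.trajectory κ τ 0 σ vin dW n).1 = lift hD hp (path hD hp hκ hσ hτ vin dW n) := by
  induction n with
  | zero =>
    have h : D.IsInitial vin (D.trajectory κ τ 0 σ vin dW 0) :=
      Classical.epsilon_spec (exists_isInitial hD hp vin)
    exact ⟨h.1, h.fst_eq hD hp⟩
  | succ n ih =>
    have hs := stepMap_spec hD hp hκ hσ hτ (path hD hp hκ hσ hτ vin dW n, dW n)
    have h : D.IsStep κ τ 0 σ (dW n) (D.trajectory κ τ 0 σ vin dW n)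
        (D.trajectory κ τ 0 σ vin dW (n + 1)) :=
      Classical.epsilon_spec (exists_isStep hD hp hκ hσ ih.1 ih.2 hs)
    refine ⟨h.1, ?_⟩
    obtain ⟨u', hu', hstep⟩ := h.exists_midpointStep hD hp hκ hσ ih.1 ih.2
    rw [hu', (isDissipative hD hp hκ hσ).step_unique hτ hstep hs]
    rfl

theorem vel_trajectory (hD : D.IsStable Γ) (hp : 1 < p) (hκ : 0 ≤ κ)
    (hσ : MemLp σ ∞ (volume.restrict O)) (hτ : 0 ≤ τ) (vin : L2 O) (dW : ℕ → ℝ) (n : ℕ) :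
    D.vel (D.trajectory κ τ 0 σ vin dW n).1 = path hD hp hκ hσ hτ vin dW n := by
  rw [(trajectory_spec hD hp hκ hσ hτ vin dW n).2, vel_lift]

theorem tendsto_path (hD : D.IsStable Γ) (hp : 1 < p) (hκ : 0 ≤ κ)
    (hσ : MemLp σ ∞ (volume.restrict O)) (hτ : 0 < τ) (vin : L2 O) {dW : ℕ → ℝ} {R : ℝ}
    (hR : ∃ᶠ n in atTop, |dW n| ≤ R) :
    Tendsto (path hD hp hκ hσ hτ.le vin dW) atTop (𝓝 0) :=
  (isDissipative hD hp hκ hσ).tendsto_zero hτ (fun _ => stepMap_spec hD hp hκ hσ hτ.le _) hR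

theorem path_zero (hD : D.IsStable Γ) (hp : 1 < p) (hκ : 0 ≤ κ)
    (hσ : MemLp σ ∞ (volume.restrict O)) (hτ : 0 ≤ τ) (dW : ℕ → ℝ) (n : ℕ) :
    path hD hp hκ hσ hτ 0 dW n = 0 := by
  induction n with
  | zero => exact map_zero _
  | succ n ih =>
    have := (isDissipative hD hp hκ hσ).norm_step_le hτ
      (stepMap_spec hD hp hκ hσ hτ (path hD hp hκ hσ hτ 0 dW n, dW n))
    rw [ih, norm_zero] at this
    rw [path, ih]
    exact norm_le_zero_iff.1 this

theorem continuous_path (hD : D.IsStable Γ) (hp : 1 < p) (hκ : 0 ≤ κ)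
    (hσ : MemLp σ ∞ (volume.restrict O)) (hτ : 0 ≤ τ) (dW : ℕ → ℝ) (n : ℕ) :
    Continuous fun vin => path hD hp hκ hσ hτ vin dW n := by
  induction n with
  | zero => exact (velSpace hD hp).orthogonalProjectionOnto.continuous
  | succ n ih => exact (continuous_stepMap hD hp hκ hσ hτ).comp (ih.prodMk continuous_const)

variable {Ω : Type*} [MeasurableSpace Ω] {P : Measure Ω}

/-- Although steps are selected by choice, uniqueness makes the step map continuous, and
measurability in `ω` follows by composition. -/
theorem aestronglyMeasurable_path (hD : D.IsStable Γ) (hp : 1 < p) (hκ : 0 ≤ κ)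
    (hσ : MemLp σ ∞ (volume.restrict O)) (hτ : 0 ≤ τ) (vin : L2 O) {dW : ℕ → Ω → ℝ}
    (hdW : ∀ n, AEStronglyMeasurable (dW n) P) (n : ℕ) :
    AEStronglyMeasurable (fun ω => path hD hp hκ hσ hτ vin (fun k => dW k ω) n) P := by
  induction n with
  | zero => exact aestronglyMeasurable_const
  | succ n ih =>
    exact (continuous_stepMap hD hp hκ hσ hτ).comp_aestronglyMeasurable (ih.prodMk (hdW n))

end GradientDiscretisation

/-! ### Recurrence of bounded increments and convergence of averaged laws -/

section Probability

variable {Ω : Type*} [MeasurableSpace Ω] {P : Measure Ω}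

/-- Identically distributed real random variables almost surely do not tend to infinity. -/
theorem ae_exists_frequently_abs_le {ν : Measure ℝ} (hν : MemLp id 1 ν) {ξ : ℕ → Ω → ℝ}
    (hξ : ∀ n, HasLaw (ξ n) ν P) : ∀ᵐ ω ∂P, ∃ R, ∃ᶠ n in atTop, |ξ n ω| ≤ R := by
  have hm : ∀ n, AEMeasurable (fun ω => ‖ξ n ω‖ₑ) P := fun n => (hξ n).aemeasurable.enorm
  have hlaw : ∀ n, ∫⁻ ω, ‖ξ n ω‖ₑ ∂P = ∫⁻ x, ‖x‖ₑ ∂ν := fun n => by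
    rw [← (hξ n).map_eq, lintegral_map' (by fun_prop) (hξ n).aemeasurable]
  -- Fatou: the expected lower limit is at most the common first absolute moment.
  have hfin : ∫⁻ ω, liminf (fun n => ‖ξ n ω‖ₑ) atTop ∂P ≠ ∞ := by
    refine ne_top_of_le_ne_top ?_ (lintegral_liminf_le' hm)
    simp only [hlaw, liminf_const]
    have := hν.eLpNorm_ne_top
    rwa [eLpNorm_one_eq_lintegral_enorm] at this
  have hmeas : AEMeasurable (fun ω => liminf (fun n => ‖ξ n ω‖ₑ) atTop) P := by
    refine ⟨_, Measurable.liminf fun n => (hm n).measurable_mk, ?_⟩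
    filter_upwards [ae_all_iff.2 fun n => (hm n).ae_eq_mk] with ω hω
    simp only [hω]
  filter_upwards [ae_lt_top' hmeas hfin] with ω hω
  obtain ⟨R, hR, hR'⟩ := exists_between hω
  refine ⟨R.toReal, (frequently_lt_of_liminf_lt (by isBoundedDefault) hR).mono fun n hn => ?_⟩
  have := ENNReal.toReal_mono hR'.ne hn.le
  rwa [toReal_enorm] at this

variable [IsProbabilityMeasure P] {H : Type*} [TopologicalSpace H]

theorem tendsto_integral_comp {Z : ℕ → Ω → H}
    (hZ : ∀ n, AEStronglyMeasurable (Z n) P) {a : H}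
    (hlim : ∀ᵐ ω ∂P, Tendsto (fun n => Z n ω) atTop (𝓝 a)) (f : H →ᵇ ℝ) :
    Tendsto (fun n => ∫ ω, f (Z n ω) ∂P) atTop (𝓝 (f a)) := by
  have : Tendsto (fun n => ∫ ω, f (Z n ω) ∂P) atTop (𝓝 (∫ _, f a ∂P)) := by
    refine tendsto_integral_of_dominated_convergence (fun _ => ‖f‖)
      (fun n => f.continuous.comp_aestronglyMeasurable (hZ n)) (integrable_const _)
      (fun n => ae_of_all _ fun ω => f.norm_coe_le_norm _) ?_
    filter_upwards [hlim] with ω hω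
    exact (f.continuous.tendsto a).comp hω
  simpa using this

/-- Averaged laws of an almost surely convergent sequence converge weakly to a Dirac measure. -/
theorem weaklyTendsto_averagedLaw [TopologicalSpace.PseudoMetrizableSpace H] [MeasurableSpace H]
    [BorelSpace H] {Z : ℕ → Ω → H}
    (hZ : ∀ n, AEStronglyMeasurable (Z n) P) {a : H}
    (hlim : ∀ᵐ ω ∂P, Tendsto (fun n => Z n ω) atTop (𝓝 a)) :
    WeaklyTendsto (averagedLaw P Z) (Measure.dirac a) := by
  intro f
  rw [integral_dirac' f a f.continuous.stronglyMeasurable]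
  -- Integrals against the averaged laws are Cesàro means of the convergent expectations.
  refine (tendsto_integral_comp hZ hlim f).cesaro.congr fun N => ?_
  have hint : ∀ n, Integrable f (P.map (Z n)) := fun n =>
    have := Measure.isProbabilityMeasure_map (hZ n).aemeasurable
    f.integrable _
  rw [averagedLaw, integral_smul_measure, integral_finsetSum_measure fun n _ => hint n]
  simp only [ENNReal.toReal_inv, ENNReal.toReal_natCast, smul_eq_mul]
  congr 1
  refine Finset.sum_congr rfl fun n _ => ?_
  rw [integral_map (hZ n).aemeasurable f.continuous.aestronglyMeasurable]

end Probability

end StochStokes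

/-! ### Brownian increments, invariant measures and the main theorem -/

namespace StochStokes

/-- The increments of a Brownian motion over steps of length `τ` are Gaussian of variance `τ`. -/
theorem hasLaw_increment {Ω : Type*} [MeasurableSpace Ω] {P : Measure Ω} {W : ℝ≥0 → Ω → ℝ}
    (hW : IsBrownianReal W P) (τ : ℝ≥0) (k : ℕ) :
    HasLaw (fun ω => W (((k + 1 : ℕ) : ℝ≥0) * τ) ω - W ((k : ℝ≥0) * τ) ω) (gaussianReal 0 τ) P := by
  have h := hW.toIsPreBrownianReal.hasLaw_sub (((k + 1 : ℕ) : ℝ≥0) * τ) ((k : ℝ≥0) * τ)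
  have e : nndist (((k + 1 : ℕ) : ℝ≥0) * τ).1 ((k : ℝ≥0) * τ).1 = τ := by
    refine NNReal.eq ?_
    rw [coe_nndist, Real.dist_eq]
    change |((((k + 1 : ℕ) : ℝ≥0) * τ : ℝ≥0) : ℝ) - (((k : ℝ≥0) * τ : ℝ≥0) : ℝ)| = τ
    push_cast
    rw [show ((k : ℝ) + 1) * τ - k * τ = τ by ring, abs_of_nonneg τ.coe_nonneg]
  rw [e] at h
  exact h

namespace GradientDiscretisation

variable {d : ℕ} {O : Set (Vec d)} {p κ : ℝ} {τ : ℝ≥0} {X Y : Type*}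
  [AddCommGroup X] [Module ℝ X] [FiniteDimensional ℝ X]
  [AddCommGroup Y] [Module ℝ Y] [FiniteDimensional ℝ Y]
  {D : GradientDiscretisation O p X Y} {Γ : ℝ} {σ : Vec d → Vec d}
  {Ω : Type*} {W : ℝ≥0 → Ω → ℝ}

theorem vel_solHalf (n : ℕ) (vin : L2 O) (ω : Ω) (g : Vec d → Vec d) :
    D.vel (D.solHalf κ τ g σ W n vin ω) = (1 / 2 : ℝ) •
      (D.vel (D.sol κ τ g σ W (n + 1) vin ω) + D.vel (D.sol κ τ g σ W n vin ω)) := by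
  rw [solHalf, map_smul, map_add]

variable [IsFiniteMeasure (volume.restrict O)]

theorem vel_sol (hD : D.IsStable Γ) (hp : 1 < p) (hκ : 0 ≤ κ)
    (hσ : MemLp σ ∞ (volume.restrict O)) (n : ℕ) (vin : L2 O) (ω : Ω) :
    D.vel (D.sol κ τ 0 σ W n vin ω) = path hD hp hκ hσ τ.2 vin
      (fun k => W (((k + 1 : ℕ) : ℝ≥0) * τ) ω - W ((k : ℝ≥0) * τ) ω) n :=
  vel_trajectory hD hp hκ hσ τ.2 vin _ n

variable [MeasurableSpace Ω] {P : Measure Ω}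

theorem aestronglyMeasurable_vel_sol (hD : D.IsStable Γ) (hp : 1 < p) (hκ : 0 ≤ κ)
    (hσ : MemLp σ ∞ (volume.restrict O)) (hW : IsBrownianReal W P) (n : ℕ) (vin : L2 O) :
    AEStronglyMeasurable (fun ω => D.vel (D.sol κ τ 0 σ W n vin ω)) P := by
  simp only [vel_sol hD hp hκ hσ]
  exact continuous_subtype_val.comp_aestronglyMeasurable
    (aestronglyMeasurable_path hD hp hκ hσ τ.2 vin
      (fun k => (hasLaw_increment hW τ k).aemeasurable.aestronglyMeasurable) n)

theorem ae_tendsto_vel_sol (hD : D.IsStable Γ) (hp : 1 < p) (hκ : 0 ≤ κ) (hτ : 0 < τ)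
    (hσ : MemLp σ ∞ (volume.restrict O)) (hW : IsBrownianReal W P) (vin : L2 O) :
    ∀ᵐ ω ∂P, Tendsto (fun n => D.vel (D.sol κ τ 0 σ W n vin ω)) atTop (𝓝 0) := by
  filter_upwards [ae_exists_frequently_abs_le (memLp_id_gaussianReal 1)
    (hasLaw_increment hW τ)] with ω ⟨R, hR⟩
  simp only [vel_sol hD hp hκ hσ]
  exact (continuous_subtype_val.tendsto _).comp
    (tendsto_path hD hp hκ hσ (NNReal.coe_pos.2 hτ) vin hR)

theorem continuous_semigroup [IsProbabilityMeasure P] (hD : D.IsStable Γ) (hp : 1 < p)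
    (hκ : 0 ≤ κ) (hσ : MemLp σ ∞ (volume.restrict O)) (hW : IsBrownianReal W P) (n : ℕ)
    (f : L2 O →ᵇ ℝ) : Continuous (D.semigroup κ τ 0 σ W P n f) := by
  refine continuous_of_dominated (bound := fun _ => ‖f‖)
    (fun vin => f.continuous.comp_aestronglyMeasurable
      (aestronglyMeasurable_vel_sol hD hp hκ hσ hW n vin))
    (fun vin => ae_of_all _ fun ω => f.norm_coe_le_norm _) (integrable_const _)
    (ae_of_all _ fun ω => ?_)
  simp only [vel_sol hD hp hκ hσ]
  exact f.continuous.comp (continuous_subtype_val.comp (continuous_path hD hp hκ hσ τ.2 _ n))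

/-- Pathwise decay gives `Pⁿ f → f 0` pointwise, with the uniform bound `‖f‖`. An invariant `μ` thus
integrates every bounded continuous `f` to `f 0`. Conversely, norm decay keeps the path started at
zero at zero. -/
theorem isInvariant_iff [IsProbabilityMeasure P] (hD : D.IsStable Γ) (hp : 1 < p)
    (hκ : 0 ≤ κ) (hτ : 0 < τ) (hσ : MemLp σ ∞ (volume.restrict O)) (hW : IsBrownianReal W P)
    (μ : Measure (L2 O)) [IsProbabilityMeasure μ] :
    D.IsInvariant κ τ 0 σ W P μ ↔ μ = Measure.dirac 0 := by
  constructor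
  · intro h
    refine ext_of_forall_integral_eq_of_IsFiniteMeasure fun f => ?_
    rw [integral_dirac' f 0 f.continuous.stronglyMeasurable]
    have h1 : Tendsto (fun n => ∫ v, D.semigroup κ τ 0 σ W P n f v ∂μ) atTop
        (𝓝 (∫ _, f 0 ∂μ)) := by
      refine tendsto_integral_of_dominated_convergence (fun _ => ‖f‖)
        (fun n => (continuous_semigroup hD hp hκ hσ hW n f).aestronglyMeasurable)
        (integrable_const _) (fun n => ae_of_all _ fun v => ?_) (ae_of_all _ fun v => ?_)
      · have := norm_integral_le_of_norm_le_const (μ := P) (C := ‖f‖)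
          (f := fun ω => f (D.vel (D.sol κ τ 0 σ W n v ω)))
          (ae_of_all _ fun ω => f.norm_coe_le_norm _)
        simpa [semigroup] using this
      · exact tendsto_integral_comp
          (fun n => aestronglyMeasurable_vel_sol hD hp hκ hσ hW n v)
          (ae_tendsto_vel_sol hD hp hκ hτ hσ hW v) f
    have h2 : Tendsto (fun n => ∫ v, D.semigroup κ τ 0 σ W P n f v ∂μ) atTop
        (𝓝 (∫ v, f v ∂μ)) :=
      tendsto_const_nhds.congr' ((eventually_ge_atTop 1).mono fun n hn => (h n hn f).symm)
    simpa using tendsto_nhds_unique h2 h1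
  · rintro rfl n - f
    rw [integral_dirac' _ _ (continuous_semigroup hD hp hκ hσ hW n f).stronglyMeasurable,
      integral_dirac' _ _ f.continuous.stronglyMeasurable]
    simp [semigroup, vel_sol hD hp hκ hσ, path_zero]

end GradientDiscretisation

end StochStokes

open StochStokes
theorem mainTheorem7 {d : ℕ} (O : Set (Vec d)) (hO_open : IsOpen O) (hO_conn : IsConnected O)
    (hO_bdd : Bornology.IsBounded O)
    (p κ : ℝ) (hp : 1 < p) (hκ : 0 ≤ κ)
    (τ : ℝ≥0) (hτ : 0 < τ)
    (σ : Vec d → Vec d) (hσ : MemLp σ ∞ (volume.restrict O))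
    {X Y : Type*} [AddCommGroup X] [Module ℝ X] [FiniteDimensional ℝ X]
    [AddCommGroup Y] [Module ℝ Y] [FiniteDimensional ℝ Y]
    (D : GradientDiscretisation O p X Y) (Γ : ℝ) (hΓ : 1 ≤ Γ) (hD : D.IsStable Γ)
    {Ω : Type*} [MeasurableSpace Ω] (P : Measure Ω) [IsProbabilityMeasure P]
    (W : ℝ≥0 → Ω → ℝ) (hW : IsBrownianReal W P)
    (g : Vec d → Vec d) (hg : g = 0) :
    (∀ μ : Measure (L2 O), IsProbabilityMeasure μ →
      (D.IsInvariant κ τ g σ W P μ ↔ μ = Measure.dirac 0)) ∧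
    ∀ vin : L2 O,
      (∀ᵐ ω ∂P, Tendsto (fun n => D.vel (D.sol κ τ g σ W n vin ω)) atTop (𝓝 0)) ∧
      (∀ᵐ ω ∂P, Tendsto (fun n => D.vel (D.solHalf κ τ g σ W n vin ω)) atTop (𝓝 0)) ∧
      WeaklyTendsto (averagedLaw P fun n ω => D.vel (D.sol κ τ g σ W n vin ω))
        (Measure.dirac 0) ∧
      WeaklyTendsto (averagedLaw P fun n ω => D.vel (D.solHalf κ τ g σ W n vin ω))
        (Measure.dirac 0) := by
  subst hg
  have : IsFiniteMeasure (volume.restrict O) :=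
    ⟨by rw [Measure.restrict_apply_univ]; exact hO_bdd.measure_lt_top⟩
  refine ⟨fun μ _ => GradientDiscretisation.isInvariant_iff hD hp hκ hτ hσ hW μ, fun vin => ?_⟩
  have hm := fun n => GradientDiscretisation.aestronglyMeasurable_vel_sol (τ := τ) hD hp hκ hσ hW
    n vin
  have hlim := GradientDiscretisation.ae_tendsto_vel_sol hD hp hκ hτ hσ hW vin
  have hm' : ∀ n, AEStronglyMeasurable (fun ω => D.vel (D.solHalf κ τ 0 σ W n vin ω)) P := by
    intro n
    simp only [GradientDiscretisation.vel_solHalf]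
    exact ((hm (n + 1)).add (hm n)).const_smul (1 / 2 : ℝ)
  have hlim' : ∀ᵐ ω ∂P, Tendsto (fun n => D.vel (D.solHalf κ τ 0 σ W n vin ω)) atTop (𝓝 0) := by
    filter_upwards [hlim] with ω hω
    simp only [GradientDiscretisation.vel_solHalf]
    simpa using ((hω.comp (tendsto_add_atTop_nat 1)).add hω).const_smul (1 / 2 : ℝ)
  exact ⟨hlim, hlim', weaklyTendsto_averagedLaw hm hlim, weaklyTendsto_averagedLaw hm' hlim'⟩
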